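/- A weighted directed graph $G=(V,m,E,a)$ consists of a node set $V$, masses $m:V\to(0,\infty)$, edges $E\subseteq V\times V$ and weights $a:V\times V\to[0,\infty)$ with $a(x,y)>0$ iff $(x,y)\in E$; the edge $(x,y)$ originates at $y$ and terminates at $x$. Let $V$ be finite. The space $\ell^2(G)$ consists of the functions $V\to\mathbb C$ with inner product $\langle f,g\rangle=\sum_x\overline{f(x)}g(x)m(x)$, and the in-degree Laplacian of $G$ is $$[L^-f](x)=\frac1{m(x)}\Big(d^-(x)f(x)-\sum_{y}a(x,y)f(y)\Big),\qquad d^-(x)=\sum_y a(x,y).$$ Let $\tilde E\subseteq E$ be any set of edges. Write $L^-_{\tilde E}$ and $L^-_{E\setminus\tilde E}$ for the in-degree Laplacians of the graphs obtained from $G$ by keeping only the edges in $\tilde E$, respectively in $E\setminus\tilde E$, and put $L^-_\beta=L^-_{E\setminus\tilde E}+\beta L^-_{\tilde E}$. In $(V,\tilde E)$, a node $i$ sees $j$ if there is a (possibly trivial) directed path from $j$ to $i$. A reach is a maximal set among the sets $\{i: i\text{ sees }j\}$, $j\in V$. The exclusive part $H(R)$ of a reach $R$ is the set of nodes of $R$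 that see no node of any other reach, and its common part is $C(R)=R\setminus H(R)$. For each reach $R$ let: * $\vec\gamma_R:V\to\mathbb R$ be equal to $1$ on $H(R)$, to $0$ outside $R$, and to $-[\chi_{C(R)}L^-_{\tilde E}{\restriction_{C(R)}}]^{-1}[\chi_{C(R)}L^-_{\tilde E}\chi_{H(R)}]$ on $C(R)$; * $\omega_R(i)$ be the sum, over all directed spanning trees of $R$ with edges in $\tilde E$ and root $i\in R$ (edges pointing away from the root), of the product of the weights $a$ of the edges of the tree ($\omega_R(i)=0$ for $i\notin R$), and $\overleftarrow\gamma_R=\omega_R/\sum_i\omega_R(i)m(i)$. Let $P^-=\frac1{2\pi i}\oint_{|z|=\varepsilon}(z-L^-_{\tilde E})^{-1}dz$ (with $\varepsilon>0$ small) be the Riesz projection of $L^-_{\tilde E}$ onto $0$. The reduced graph $\underline G^-$ has the reaches of $(V,\tilde E)$ as its nodes, the masses $\underline m^-(R)=\langle\chi_R,P^-\chi_R\rangle$, the weights $$\underline a^-(R,S)=\underline m^-(R)\sum_{r\in R,\,s\in S}\overleftarrow\gamma_R(r)\,a(r,s)\,\vec\gamma_S(s),$$ and the edges $(R,S)$ with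 $\underline a^-(R,S)>0$. Let $\underline L^-$ be its in-degree Laplacian, and let $$[J^-_\downarrow f](R)=\langle\overleftarrow\gamma_R,f\rangle_{\ell^2(G)},\qquad J^-_\uparrow g=\sum_R g(R)\,\vec\gamma_R .$$ **Theorem.** $\underline G^-$ is a weighted directed graph in the above sense (in particular $\underline m^->0$ and $\underline a^-\ge0$), and for every $t>0$, in the operator norm on $\ell^2(G)$, $$\big\|e^{-tL^-_\beta}-J^-_\uparrow e^{-t\underline L^-}J^-_\downarrow\big\|\longrightarrow 0\qquad\text{as }\beta\to\infty .$$ -/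

import Mathlib

/-- The data of a weighted directed graph `G = (V, m, E, a)`. The pair `(x, y)` stands for the edge
which originates at `y` and terminates at `x`. -/
structure WeightedDigraph (V : Type*) where
  /-- node masses -/
  m : V → ℝ
  /-- edges -/
  E : Set (V × V)
  /-- edge weights -/
  a : V → V → ℝ

namespace WeightedDigraph

/-- The laws of a weighted directed graph: positive masses, non-negative weights, and `E` is exactly
the set on which the weight is positive. -/
structure IsGraph {V : Type*} (G : WeightedDigraph V) : Prop where
  m_pos : ∀ v, 0 < G.m v
  a_nonneg : ∀ x y, 0 ≤ G.a x y
  mem_E : ∀ x y, (x, y) ∈ G.E ↔ 0 < G.a x y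

open Classical in
/-- The graph with the same nodes and masses which keeps only the edges lying in `F`. -/
noncomputable def restrict {V : Type*} (G : WeightedDigraph V) (F : Set (V × V)) :
    WeightedDigraph V where
  m := G.m
  E := G.E ∩ F
  a x y := if (x, y) ∈ F then G.a x y else 0

/-! ### Reaches -/

/-- `i` sees `j`: there is a (possibly trivial) directed path from `j` to `i`. -/
def Sees {V : Type*} (G : WeightedDigraph V) (i j : V) : Prop :=
  Relation.ReflTransGen (fun x y => (x, y) ∈ G.E ∧ G.a x y ≠ 0) i j

/-- All nodes that can be reached from `i` by following directed edges. -/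
def reachableSet {V : Type*} (G : WeightedDigraph V) (i : V) : Set V := {j | G.Sees j i}

/-- A reach is a maximal reachable set. -/
def IsReach {V : Type*} (G : WeightedDigraph V) (R : Set V) : Prop :=
  Maximal (fun S => ∃ i, S = G.reachableSet i) R

/-- The type of all reaches of `G`. -/
def Reach {V : Type*} (G : WeightedDigraph V) : Type _ := {R : Set V // G.IsReach R}

noncomputable instance {V : Type*} [Fintype V] (G : WeightedDigraph V) : Fintype G.Reach :=
  Fintype.ofInjective (fun R : G.Reach => R.1) Subtype.val_injective

/-- The exclusive part of a reach: its nodes which see no node of any other reach. -/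
def exclusivePart {V : Type*} (G : WeightedDigraph V) (R : G.Reach) : Set V :=
  {j | j ∈ R.1 ∧ ∀ S : G.Reach, S ≠ R → ∀ k ∈ S.1, ¬ G.Sees j k}

/-- The common part of a reach: its nodes which also see nodes of some other reach. -/
def commonPart {V : Type*} (G : WeightedDigraph V) (R : G.Reach) : Set V :=
  {j | j ∈ R.1 ∧ ∃ S : G.Reach, S ≠ R ∧ ∃ k ∈ S.1, G.Sees j k}

/-! ### The in-degree Laplacian and the space `ℓ²(G)` -/

/-- The in-degree of a node. -/
noncomputable def inDegree {V : Type*} [Fintype V] (G : WeightedDigraph V) (v : V) : ℝ :=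
  ∑ i, G.a v i

/-- The in-degree Laplacian as a linear map on `𝕜`-valued functions, for `𝕜 = ℝ` or `𝕜 = ℂ`. -/
noncomputable def inLapLin {V : Type*} [Fintype V] (𝕜 : Type*) [RCLike 𝕜]
    (G : WeightedDigraph V) : (V → 𝕜) →ₗ[𝕜] (V → 𝕜) where
  toFun f x := (1 / (G.m x : 𝕜)) * ((G.inDegree x : 𝕜) * f x - ∑ y, (G.a x y : 𝕜) * f y)
  map_add' f g := by
    funext x
    simp only [Pi.add_apply, mul_add, Finset.sum_add_distrib]
    ring
  map_smul' c f := by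
    funext x
    simp only [Pi.smul_apply, smul_eq_mul, RingHom.id_apply, mul_left_comm _ c, ← Finset.mul_sum,
      ← mul_sub]

/-- The in-degree Laplacian as a bounded operator on complex functions. The nodes are finite in
number, so that `ℓ²(G)` is the space of all functions `V → ℂ`. -/
noncomputable def inLap {V : Type*} [Fintype V] (G : WeightedDigraph V) :
    (V → ℂ) →L[ℂ] (V → ℂ) :=
  LinearMap.toContinuousLinearMap (G.inLapLin ℂ)

/-- The inner product of `ℓ²(G)`. -/
noncomputable def ellInner {V : Type*} [Fintype V] (G : WeightedDigraph V) (f g : V → ℂ) : ℂ :=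
  ∑ x, (starRingEnd ℂ) (f x) * g x * (G.m x : ℂ)

/-- The norm of `ℓ²(G)`. -/
noncomputable def ellNorm {V : Type*} [Fintype V] (G : WeightedDigraph V) (f : V → ℂ) : ℝ :=
  Real.sqrt (∑ x, ‖f x‖ ^ 2 * G.m x)

/-- The operator norm of an operator on `ℓ²(G)`. -/
noncomputable def ellOpNorm {V : Type*} [Fintype V] (G : WeightedDigraph V)
    (T : (V → ℂ) →L[ℂ] (V → ℂ)) : ℝ :=
  sInf {C : ℝ | 0 ≤ C ∧ ∀ f, G.ellNorm (T f) ≤ C * G.ellNorm f}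

/-! ### Right and left kernel vectors of the in-degree Laplacian -/

/-- The operator `χ_C · L|_C` on functions on the common part `C` of the reach `R`. -/
noncomputable def commonBlock {V : Type*} [Fintype V] (G : WeightedDigraph V) (R : G.Reach) :
    Module.End ℝ (G.commonPart R → ℝ) :=
  LinearMap.funLeft ℝ ℝ Subtype.val ∘ₗ G.inLapLin ℝ ∘ₗ
    Function.ExtendByZero.linearMap ℝ Subtype.val

open Classical in
/-- The right kernel vector of the reach `R`: equal to `1` on the exclusive part `H`, equal to
`-[χ_C L|_C]⁻¹ [χ_C L χ_H]` on the common part `C`, and `0` outside of `R`. -/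
noncomputable def rightVec {V : Type*} [Fintype V] (G : WeightedDigraph V) (R : G.Reach) (j : V) :
    ℝ :=
  if h : j ∈ G.commonPart R then
    -(Ring.inverse (G.commonBlock R)
      (fun x => G.inLapLin ℝ (Set.indicator (G.exclusivePart R) 1) x.1)) ⟨j, h⟩
  else if j ∈ G.exclusivePart R then 1 else 0

/-- `τ` is (the edge set of) a directed spanning tree of `R` with root `i`: its edges join nodes of
`R`, no edge enters the root, every node has at most one incoming edge, and every node of `R` is
reached from the root along `τ`. -/
structure IsSpanningTree {V : Type*} (G : WeightedDigraph V) (R : Set V) (i : V)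
    (τ : Finset (V × V)) : Prop where
  root_mem : i ∈ R
  edge : ∀ e ∈ τ, e ∈ G.E ∧ e.1 ∈ R ∧ e.2 ∈ R
  root : ∀ e ∈ τ, e.1 ≠ i
  unique_incoming : ∀ e ∈ τ, ∀ e' ∈ τ, e.1 = e'.1 → e = e'
  spanning : ∀ v ∈ R, Relation.ReflTransGen (fun x y => (x, y) ∈ τ) v i

open Classical in
/-- The weight vector of a set of nodes `R` (in use: a reach): the sum over all spanning trees of
`R` rooted at `i` of the products of their edge weights. -/
noncomputable def weightVec {V : Type*} [Fintype V] (G : WeightedDigraph V) (R : Set V) (i : V) :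
    ℝ :=
  ∑ τ : Finset (V × V) with G.IsSpanningTree R i τ, ∏ e ∈ τ, G.a e.1 e.2

/-- The left kernel vector of the reach `R`: the multiple of the weight vector whose inner products
with the functions `e_j` sum up to `1`, that is `∑ j, leftVec j * m j = 1`. -/
noncomputable def leftVec {V : Type*} [Fintype V] (G : WeightedDigraph V) (R : G.Reach) (j : V) :
    ℝ :=
  G.weightVec R.1 j / ∑ i, G.weightVec R.1 i * G.m i

/-! ### The reduced graph -/

/-- The contour integral `(2πi)⁻¹ ∮ (z - B)⁻¹ dz` over the positively oriented circle of radius `ε`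
around `0`. -/
noncomputable def rieszIntegral {V : Type*} [Fintype V] (B : (V → ℂ) →L[ℂ] (V → ℂ)) (ε : ℝ) :
    (V → ℂ) →L[ℂ] (V → ℂ) :=
  (2 * Real.pi * Complex.I : ℂ)⁻¹ • ∮ z in C(0, ε), resolvent B z

/-- The Riesz projection of `B` onto `0`. The contour integral takes one and the same value for all
small `ε > 0` (the circle must not enclose a non-zero point of the spectrum); this is that value. -/
noncomputable def rieszProj {V : Type*} [Fintype V] (B : (V → ℂ) →L[ℂ] (V → ℂ)) :
    (V → ℂ) →L[ℂ] (V → ℂ) :=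
  Filter.limUnder (nhdsWithin (0 : ℝ) (Set.Ioi 0)) (rieszIntegral B)

/-- The reduced graph. Its nodes are the reaches of the graph `(V, F)`. Its masses are
`⟨χ_R, P χ_R⟩` (a real number), with `P` the Riesz projection onto `0` of the in-degree Laplacian
of `F`. -/
noncomputable def reduced {V : Type*} [Fintype V] (G : WeightedDigraph V) (F : Set (V × V)) :
    WeightedDigraph (G.restrict F).Reach :=
  let m' : (G.restrict F).Reach → ℝ := fun R =>
    (G.ellInner (Set.indicator R.1 1)
      (rieszProj (G.restrict F).inLap (Set.indicator R.1 1))).re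
  let a' : (G.restrict F).Reach → (G.restrict F).Reach → ℝ := fun R S =>
    m' R * ∑ r, ∑ s, Set.indicator R.1 1 r * Set.indicator S.1 1 s *
      ((G.restrict F).leftVec R r * G.a r s * (G.restrict F).rightVec S s)
  { m := m'
    a := a'
    E := {e | 0 < a' e.1 e.2} }

/-- The projection `ℓ²(G) → ℓ²` of the reduced graph, `f ↦ (R ↦ ⟨leftVec R, f⟩)`. -/
noncomputable def Jdown {V : Type*} [Fintype V] (G : WeightedDigraph V) (F : Set (V × V)) :
    (V → ℂ) →L[ℂ] ((G.restrict F).Reach → ℂ) :=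
  LinearMap.toContinuousLinearMap
    { toFun := fun f R => G.ellInner (fun v => ((G.restrict F).leftVec R v : ℂ)) f
      map_add' := fun f g => by
        funext R
        simp only [ellInner, Pi.add_apply, mul_add, add_mul, Finset.sum_add_distrib]
      map_smul' := fun c f => by
        funext R
        simp only [ellInner, Pi.smul_apply, smul_eq_mul, RingHom.id_apply, Finset.mul_sum]
        exact Finset.sum_congr rfl fun x _ => by ring }

/-- The interpolation from `ℓ²` of the reduced graph to `ℓ²(G)`, `g ↦ ∑ R, g R • rightVec R`. -/
noncomputable def Jup {V : Type*} [Fintype V] (G : WeightedDigraph V) (F : Set (V × V)) :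
    ((G.restrict F).Reach → ℂ) →L[ℂ] (V → ℂ) :=
  LinearMap.toContinuousLinearMap
    { toFun := fun g v => ∑ R, g R * ((G.restrict F).rightVec R v : ℂ)
      map_add' := fun f g => by
        funext v
        simp only [Pi.add_apply, add_mul, Finset.sum_add_distrib]
      map_smul' := fun c f => by
        funext v
        simp only [Pi.smul_apply, smul_eq_mul, RingHom.id_apply, Finset.mul_sum]
        exact Finset.sum_congr rfl fun x _ => by ring }

/-- The in-degree Laplacian `L_{E ∖ F} + β L_F`, that is, with the weights on `F` scaled by `β`. -/
noncomputable def inLapBeta {V : Type*} [Fintype V] (G : WeightedDigraph V) (F : Set (V × V))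
    (β : ℝ) : (V → ℂ) →L[ℂ] (V → ℂ) :=
  (G.restrict (G.E \ F)).inLap + (β : ℂ) • (G.restrict F).inLap

end WeightedDigraph

namespace WeightedDigraph

variable {V : Type*} {G : WeightedDigraph V}

/-! Write `B` for the Laplacian of `F` and `A` for that of `E \ F`. The heart of the matter is a
singular perturbation: as `β → ∞`, the semigroup of `-(A + βB)` collapses onto `ker B`, where it is
generated by the compression of `-A`.

Algebra. By the maximum principle the vectors `rightVec` form a basis of `ker B`, are nonnegative
and sum to `1`; the coordinates of a kernel element are its values at roots of the reaches. The
Markov chain tree theorem (`weightVec_balance`) makes the vectors `leftVec` left kernel vectors;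
each is a probability density supported on the roots of its reach. Hence `Jdown ∘ Jup = 1`, and `P =
Jup ∘ Jdown` is a projection onto `ker B` with `BP = PB = 0` and `B + P` invertible. So `P` is the
Riesz projection (`rieszProj_eq`), which identifies the reduced masses, and the reduced Laplacian
equals `Jdown ∘ A ∘ Jup` (`reduced_inLap`).

Analysis (`tendsto_exp_add_smul`). In the supremum norm `A + βB = c(1 + β)(1 - K)` with a
contraction `K`. This gives `‖e^{-t(A + βB)}‖ ≤ 1` and, by a Poisson variance estimate, `‖e^{-t(A +
βB)} B‖ = O(β^{-1/2})`. Since `1 - P` factors through `B`, the part off the kernel disappears. On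
the kernel, `Jup` corrected at order `1/β` intertwines the two generators up to `O(1/β)`, and
Duhamel's formula concludes. No spectral gap is needed. -/

lemma IsGraph.restrict (hG : G.IsGraph) {F : Set (V × V)} : (G.restrict F).IsGraph where
  m_pos := hG.m_pos
  a_nonneg x y := by
    simp only [WeightedDigraph.restrict]
    split_ifs
    exacts [hG.a_nonneg x y, le_rfl]
  mem_E x y := by
    simp only [WeightedDigraph.restrict, Set.mem_inter_iff, hG.mem_E]
    split_ifs with h <;> simp [h]

lemma IsGraph.a_eq_zero (hG : G.IsGraph) {x y : V} (h : (x, y) ∉ G.E) : G.a x y = 0 :=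
  le_antisymm (not_lt.1 fun h' => h ((hG.mem_E x y).2 h')) (hG.a_nonneg x y)

lemma IsGraph.sees_of_mem (hG : G.IsGraph) {x y : V} (h : (x, y) ∈ G.E) : G.Sees x y :=
  Relation.ReflTransGen.single ⟨h, ((hG.mem_E x y).1 h).ne'⟩

lemma Sees.refl (x : V) : G.Sees x x := Relation.ReflTransGen.refl

lemma Sees.trans {x y z : V} (h : G.Sees x y) (h' : G.Sees y z) : G.Sees x z :=
  Relation.ReflTransGen.trans h h'

/-! ### Reaches and their roots -/

/-- A root of a reach: a node from which the whole reach emanates. -/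
def IsRoot (R : G.Reach) (r : V) : Prop := R.1 = G.reachableSet r

lemma exists_isRoot (R : G.Reach) : ∃ r, IsRoot R r := R.2.prop

lemma IsRoot.mem {R : G.Reach} {r : V} (h : IsRoot R r) : r ∈ R.1 := by
  rw [h]; exact Sees.refl r

lemma IsRoot.sees {R : G.Reach} {r v : V} (h : IsRoot R r) (hv : v ∈ R.1) : G.Sees v r := by
  rw [h] at hv; exact hv

lemma Reach.mem_of_sees (R : G.Reach) {v w : V} (hw : w ∈ R.1) (h : G.Sees v w) : v ∈ R.1 := by
  obtain ⟨r, hr⟩ := exists_isRoot R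
  have h1 := hr.sees hw
  rw [hr]
  exact h.trans h1

/-- Maximality of a reach turns the inclusion in `G.reachableSet r` into equality. -/
lemma isRoot_of_sees (R : G.Reach) {r : V} (hr : ∀ v ∈ R.1, G.Sees v r) : IsRoot R r :=
  R.2.eq_of_subset ⟨r, rfl⟩ hr

lemma IsRoot.of_sees {R : G.Reach} {r y : V} (hr : IsRoot R r) (h : G.Sees r y) : IsRoot R y :=
  isRoot_of_sees R fun _ hv => (hr.sees hv).trans h

/-- A root of `S` is seen by `r`, hence is a root of `R` as well, and a root determines its reach.
Roots therefore lie in no second reach. -/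
lemma IsRoot.eq_of_mem {R S : G.Reach} {r : V} (hr : IsRoot R r) (h : r ∈ S.1) : S = R := by
  obtain ⟨s, hs⟩ := exists_isRoot S
  have h1 : IsRoot R s := hr.of_sees (hs.sees h)
  exact Subtype.ext (hs.trans h1.symm)

lemma IsRoot.mem_exclusivePart {R : G.Reach} {r : V} (hr : IsRoot R r) :
    r ∈ G.exclusivePart R :=
  ⟨hr.mem, fun S hS _ hk h => hS (hr.eq_of_mem (S.mem_of_sees hk h))⟩

lemma notMem_commonPart_of_mem_exclusivePart {R : G.Reach} {v : V}
    (h : v ∈ G.exclusivePart R) : v ∉ G.commonPart R :=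
  fun ⟨_, S, hS, k, hk, h'⟩ => h.2 S hS k hk h'

lemma mem_exclusivePart_or_mem_commonPart {R : G.Reach} {v : V} (h : v ∈ R.1) :
    v ∈ G.exclusivePart R ∨ v ∈ G.commonPart R := by
  by_cases h' : v ∈ G.commonPart R
  · exact Or.inr h'
  · refine Or.inl ⟨h, fun S hS k hk hs => h' ⟨h, S, hS, k, hk, hs⟩⟩

lemma exists_reach_mem [Finite V] (v : V) : ∃ R : G.Reach, v ∈ R.1 := by
  obtain ⟨R, hle, hR⟩ := (Set.toFinite {S : Set V | ∃ i, S = G.reachableSet i}).exists_le_maximal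
    ⟨v, rfl⟩
  exact ⟨⟨R, hR⟩, hle (Sees.refl v)⟩

lemma exists_isRoot_sees [Finite V] (v : V) : ∃ R : G.Reach, ∀ r, IsRoot R r → G.Sees v r := by
  obtain ⟨R, hR⟩ := exists_reach_mem (G := G) v
  exact ⟨R, fun r hr => hr.sees hR⟩

/-! ### The maximum principle -/

variable [Fintype V]

lemma inLapLin_apply {𝕜 : Type*} [RCLike 𝕜] (f : V → 𝕜) (x : V) :
    G.inLapLin 𝕜 f x = (1 / (G.m x : 𝕜)) * ∑ y, (G.a x y : 𝕜) * (f x - f y) := by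
  simp only [inLapLin, LinearMap.coe_mk, AddHom.coe_mk, inDegree, mul_sub, Finset.sum_sub_distrib,
    Finset.sum_mul, RCLike.ofReal_sum]

lemma inLapLin_nonpos_iff (hG : G.IsGraph) (u : V → ℝ) (x : V) :
    G.inLapLin ℝ u x ≤ 0 ↔ ∑ y, G.a x y * (u x - u y) ≤ 0 := by
  have h : 0 < 1 / G.m x := one_div_pos.2 (hG.m_pos x)
  rw [inLapLin_apply, ← not_lt, ← not_lt]
  exact not_congr (mul_pos_iff_of_pos_left h)

/-- The maximum principle for the in-degree Laplacian. -/
theorem nonpos_of_inLapLin_nonpos (hG : G.IsGraph) {u : V → ℝ} {Z : Set V}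
    (hZ : ∀ z ∈ Z, u z ≤ 0) (hu : ∀ x ∉ Z, G.inLapLin ℝ u x ≤ 0)
    (hs : ∀ x, ∃ z ∈ Z, G.Sees x z) (v : V) : u v ≤ 0 := by
  obtain ⟨x, -, hx⟩ := Finset.exists_max_image Finset.univ u ⟨v, Finset.mem_univ v⟩
  simp only [Finset.mem_univ, forall_const] at hx
  refine (hx v).trans ?_
  by_contra! hpos
  -- At a positive maximum the sum over in-neighbours is nonpositive with nonnegative terms, so
  -- every in-neighbour attains the maximum too. This propagates along a path until it meets `Z`,
  -- where `u ≤ 0`.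
  have key : ∀ w, G.Sees x w → u w = u x := by
    intro w hw
    induction hw with
    | refl => rfl
    | @tail b c _ hbc ih =>
      have hb : b ∉ Z := fun h => absurd (hZ b h) (by rw [ih]; exact not_le.2 hpos)
      have h1 := (inLapLin_nonpos_iff hG u b).1 (hu b hb)
      have h2 : ∀ y ∈ Finset.univ, 0 ≤ G.a b y * (u b - u y) := fun y _ =>
        mul_nonneg (hG.a_nonneg b y) (by rw [ih]; exact sub_nonneg.2 (hx y))
      have h3 := (Finset.sum_eq_zero_iff_of_nonneg h2).1
        (le_antisymm h1 (Finset.sum_nonneg h2)) c (Finset.mem_univ c)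
      have h4 := (mul_eq_zero.1 h3).resolve_left hbc.2
      linarith
  obtain ⟨z, hz, hxz⟩ := hs x
  exact absurd (hZ z hz) (by rw [key z hxz]; exact not_le.2 hpos)

theorem eq_zero_of_inLapLin_eq_zero (hG : G.IsGraph) {u : V → ℝ} {Z : Set V}
    (hZ : ∀ z ∈ Z, u z = 0) (hu : ∀ x ∉ Z, G.inLapLin ℝ u x = 0)
    (hs : ∀ x, ∃ z ∈ Z, G.Sees x z) : u = 0 := by
  funext v
  refine le_antisymm (nonpos_of_inLapLin_nonpos hG (fun z hz => (hZ z hz).le)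
    (fun x hx => (hu x hx).le) hs v) ?_
  have := nonpos_of_inLapLin_nonpos (u := -u) hG (fun z hz => by simp [hZ z hz])
    (fun x hx => by simp [map_neg, hu x hx]) hs v
  simpa using this

/-! ### The right kernel vectors -/

/-- A kernel vector, extended by zero, is harmonic on the common part and vanishes off it. Nodes of
the common part see a root of `R`, which is exclusive, so the maximum principle applies. -/
lemma isUnit_commonBlock (hG : G.IsGraph) (R : G.Reach) : IsUnit (G.commonBlock R) := by
  rw [LinearMap.isUnit_iff_ker_eq_bot, LinearMap.ker_eq_bot']
  intro f hf
  have hinj : Function.Injective (Subtype.val : G.commonPart R → V) := Subtype.val_injective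
  set u : V → ℝ := Function.extend Subtype.val f 0 with hu
  have h0 : ∀ z ∈ (G.commonPart R)ᶜ, u z = 0 := fun z hz => by
    rw [hu, Function.extend_apply' _ _ _ (by rintro ⟨⟨w, hw⟩, rfl⟩; exact hz hw)]
    rfl
  have h1 : ∀ x ∉ (G.commonPart R)ᶜ, G.inLapLin ℝ u x = 0 := fun x hx => by
    have := congrFun hf ⟨x, not_not.1 hx⟩
    exact this
  have h2 : ∀ x, ∃ z ∈ (G.commonPart R)ᶜ, G.Sees x z := fun x => by
    obtain ⟨r, hr⟩ := exists_isRoot R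
    by_cases hx : x ∈ G.commonPart R
    · exact ⟨r, notMem_commonPart_of_mem_exclusivePart hr.mem_exclusivePart, hr.sees hx.1⟩
    · exact ⟨x, hx, Sees.refl x⟩
  have h3 := eq_zero_of_inLapLin_eq_zero hG h0 h1 h2
  funext x
  have := congrFun h3 x.1
  rwa [hu, hinj.extend_apply] at this

lemma rightVec_of_mem_exclusivePart {R : G.Reach} {v : V} (h : v ∈ G.exclusivePart R) :
    G.rightVec R v = 1 := by
  simp [rightVec, notMem_commonPart_of_mem_exclusivePart h, h]

lemma rightVec_of_notMem {R : G.Reach} {v : V} (h : v ∉ R.1) : G.rightVec R v = 0 := by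
  have h1 : v ∉ G.commonPart R := fun h' => h h'.1
  have h2 : v ∉ G.exclusivePart R := fun h' => h h'.1
  simp [rightVec, h1, h2]

lemma mem_exclusivePart_of_sees {R : G.Reach} {x y : V} (hx : x ∈ G.exclusivePart R)
    (h : G.Sees x y) : y ∈ G.exclusivePart R := by
  obtain ⟨T, hT⟩ := exists_reach_mem (G := G) y
  have hTR : T = R := by
    by_contra hne
    exact hx.2 T hne y hT h
  subst hTR
  exact ⟨hT, fun S hS k hk h' => hx.2 S hS k hk (h.trans h')⟩

/-- On the common part this is the defining equation. Elsewhere every difference along an edge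
vanishes: exclusive nodes have only exclusive in-neighbours, and nodes outside `R` only
in-neighbours outside `R`. -/
lemma inLapLin_rightVec (hG : G.IsGraph) (R : G.Reach) : G.inLapLin ℝ (G.rightVec R) = 0 := by
  classical
  funext x
  by_cases hC : x ∈ G.commonPart R
  · set g : G.commonPart R → ℝ :=
      fun y => G.inLapLin ℝ (Set.indicator (G.exclusivePart R) 1) y.1 with hg
    set f : G.commonPart R → ℝ := Ring.inverse (G.commonBlock R) g with hf
    have hfg : G.commonBlock R f = g := by
      rw [hf, ← Module.End.mul_apply, Ring.mul_inverse_cancel _ (isUnit_commonBlock hG R),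
        Module.End.one_apply]
    have hinj : Function.Injective (Subtype.val : G.commonPart R → V) := Subtype.val_injective
    have hdec : G.rightVec R = Set.indicator (G.exclusivePart R) 1 -
        Function.extend Subtype.val f 0 := by
      funext v
      by_cases hv : v ∈ G.commonPart R
      · have hE : v ∉ G.exclusivePart R := fun h => notMem_commonPart_of_mem_exclusivePart h hv
        have := hinj.extend_apply f 0 ⟨v, hv⟩
        simp only at this
        rw [Pi.sub_apply, this, Set.indicator_of_notMem hE, zero_sub, rightVec, dif_pos hv]
      · have : Function.extend Subtype.val f 0 v = 0 := by
          rw [Function.extend_apply' _ _ _ (by rintro ⟨⟨w, hw⟩, rfl⟩; exact hv hw)]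
          rfl
        rw [Pi.sub_apply, this, sub_zero, rightVec, dif_neg hv, Set.indicator_apply]
        rfl
    have h1 : G.inLapLin ℝ (Function.extend Subtype.val f 0) x = g ⟨x, hC⟩ :=
      congrFun hfg ⟨x, hC⟩
    rw [hdec, map_sub, Pi.sub_apply, h1]
    simp [hg]
  · rw [inLapLin_apply]
    have : ∀ y, G.a x y * (G.rightVec R x - G.rightVec R y) = 0 := by
      intro y
      by_cases hE : (x, y) ∈ G.E
      · have hs := hG.sees_of_mem hE
        by_cases hx : x ∈ R.1
        · have hx' := (mem_exclusivePart_or_mem_commonPart hx).resolve_right hC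
          rw [rightVec_of_mem_exclusivePart hx',
            rightVec_of_mem_exclusivePart (mem_exclusivePart_of_sees hx' hs), sub_self, mul_zero]
        · rw [rightVec_of_notMem hx, rightVec_of_notMem fun h => hx (R.mem_of_sees h hs),
            sub_self, mul_zero]
      · rw [hG.a_eq_zero hE, zero_mul]
    simp [this]

lemma rightVec_of_isRoot [DecidableEq G.Reach] {R S : G.Reach} {r : V} (hr : IsRoot R r) :
    G.rightVec S r = if S = R then 1 else 0 := by
  split_ifs with h
  · subst h
    exact rightVec_of_mem_exclusivePart hr.mem_exclusivePart
  · exact rightVec_of_notMem fun h' => h (hr.eq_of_mem h')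

/-- Maximum principle with the set of all roots as boundary; the boundary values are `0` or `1`. -/
lemma rightVec_nonneg (hG : G.IsGraph) (R : G.Reach) (v : V) : 0 ≤ G.rightVec R v := by
  classical
  have := nonpos_of_inLapLin_nonpos (u := -G.rightVec R) (Z := {r | ∃ S : G.Reach, IsRoot S r}) hG
    (fun z ⟨S, hS⟩ => by
      rw [Pi.neg_apply, rightVec_of_isRoot hS]
      split_ifs <;> simp)
    (fun x _ => by simp [map_neg, inLapLin_rightVec hG R])
    (fun x => by
      obtain ⟨S, hS⟩ := exists_isRoot_sees (G := G) x
      obtain ⟨r, hr⟩ := exists_isRoot S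
      exact ⟨r, ⟨S, hr⟩, hS r hr⟩) v
  simpa using this

/-- Functions in the kernel of the in-degree Laplacian are combinations of the right kernel
vectors, with the values at given roots as coefficients. -/
lemma eq_sum_rightVec (hG : G.IsGraph) {ρ : G.Reach → V} (hρ : ∀ R, IsRoot R (ρ R))
    {u : V → ℝ} (hu : G.inLapLin ℝ u = 0) : u = ∑ R, u (ρ R) • G.rightVec R := by
  classical
  rw [← sub_eq_zero]
  refine eq_zero_of_inLapLin_eq_zero (Z := Set.range ρ) hG ?_ ?_ ?_
  · rintro _ ⟨S, rfl⟩
    simp [Finset.sum_apply, rightVec_of_isRoot (hρ S)]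
  · intro x _
    simp [map_sub, map_sum, map_smul, hu, inLapLin_rightVec hG]
  · intro x
    obtain ⟨S, hS⟩ := exists_isRoot_sees (G := G) x
    exact ⟨ρ S, ⟨S, rfl⟩, hS _ (hρ S)⟩

/-- The constant `1` lies in the kernel and has value `1` at every root. -/
lemma sum_rightVec (hG : G.IsGraph) (v : V) : ∑ R, G.rightVec R v = 1 := by
  choose ρ hρ using exists_isRoot (G := G)
  have := eq_sum_rightVec hG hρ (u := 1) (by funext x; simp [inLapLin_apply])
  simpa using (congrFun this v).symm

end WeightedDigraph

namespace WeightedDigraph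

variable {V : Type*} {G : WeightedDigraph V}

/-! ### Spanning trees -/

open Relation in
-- The walk may be stopped at its first visit to `z`, before it can use the step from `z` to `y`.
lemma reflTransGen_erase [DecidableEq V] {σ : Finset (V × V)} {z y v : V}
    (h : ReflTransGen (fun x y => (x, y) ∈ σ) v z) :
    ReflTransGen (fun x w => (x, w) ∈ σ.erase (z, y)) v z := by
  induction h using ReflTransGen.head_induction_on with
  | refl => exact .refl
  | @head b c hbc _ ih =>
    by_cases hb : b = z
    · subst hb; exact .refl
    · refine .head ?_ ih
      rw [Finset.mem_erase]
      exact ⟨fun h => hb (Prod.ext_iff.1 h).1, hbc⟩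

/-- Deleting the edge which enters `z` from an edge set with unique incoming edges along which every
node is reached from `z` gives a spanning tree with root `z`. -/
lemma isSpanningTree_erase [DecidableEq V] {R : Set V} {σ : Finset (V × V)} {z y : V}
    (hE : ∀ e ∈ σ, e ∈ G.E ∧ e.1 ∈ R ∧ e.2 ∈ R)
    (hu : ∀ e ∈ σ, ∀ e' ∈ σ, e.1 = e'.1 → e = e') (hz : (z, y) ∈ σ)
    (hs : ∀ v ∈ R, Relation.ReflTransGen (fun x w => (x, w) ∈ σ) v z) :
    G.IsSpanningTree R z (σ.erase (z, y)) where
  root_mem := (hE _ hz).2.1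
  edge e he := hE e (Finset.mem_of_mem_erase he)
  root e he h := (Finset.mem_erase.1 he).1 (hu e (Finset.mem_of_mem_erase he) _ hz h)
  unique_incoming e he e' he' h :=
    hu e (Finset.mem_of_mem_erase he) e' (Finset.mem_of_mem_erase he') h
  spanning v hv := reflTransGen_erase (hs v hv)

lemma IsSpanningTree.notMem {R : Set V} {τ : Finset (V × V)} {z y : V}
    (h : G.IsSpanningTree R z τ) : (z, y) ∉ τ := fun h' => h.root _ h' rfl

/-- Since incoming edges are unique, a cycle through `v` contains the whole walk from `v` to the
root, but no edge enters the root. -/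
lemma IsSpanningTree.acyclic {R : Set V} {τ : Finset (V × V)} {z : V}
    (h : G.IsSpanningTree R z τ) {v : V} (hv : v ∈ R) :
    ¬ Relation.TransGen (fun x y => (x, y) ∈ τ) v v := by
  have := h.spanning v hv
  clear hv
  induction this using Relation.ReflTransGen.head_induction_on with
  | refl =>
    intro hc
    obtain ⟨c, hc, -⟩ := Relation.TransGen.head'_iff.1 hc
    exact h.notMem hc
  | @head b c hbc _ ih =>
    intro hb
    obtain ⟨d, hd, hdb⟩ := Relation.TransGen.head'_iff.1 hb
    obtain rfl : d = c := (Prod.ext_iff.1 (h.unique_incoming _ hd _ hbc rfl)).2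
    exact ih (Relation.TransGen.tail' hdb hbc)

lemma IsSpanningTree.insert_inj [DecidableEq V] {R : Set V} {τ τ' : Finset (V × V)} {z y y' : V}
    (h : G.IsSpanningTree R z τ) (h' : G.IsSpanningTree R z τ')
    (heq : insert (z, y) τ = insert (z, y') τ') : τ = τ' ∧ y = y' := by
  have hy : y = y' := by
    have : (z, y) ∈ insert (z, y') τ' := heq ▸ Finset.mem_insert_self _ _
    rcases Finset.mem_insert.1 this with h1 | h1
    · exact (Prod.ext_iff.1 h1).2
    · exact absurd h1 h'.notMem
  subst hy
  refine ⟨?_, rfl⟩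
  rw [← Finset.erase_insert (h.notMem (y := y)), heq, Finset.erase_insert h'.notMem]

open Relation in
lemma IsSpanningTree.insert_inj_root [DecidableEq V] {R : Set V} {τ τ' : Finset (V × V)}
    {z z' x : V} (h : G.IsSpanningTree R z τ) (h' : G.IsSpanningTree R z' τ') (hx : x ∈ R)
    (heq : insert (z, x) τ = insert (z', x) τ') : z = z' ∧ τ = τ' := by
  suffices hz : z = z' by
    subst hz
    exact ⟨rfl, (h.insert_inj h' heq).1⟩
  by_contra hne
  have h1 : (z', x) ∈ τ := by
    have : (z', x) ∈ insert (z, x) τ := heq ▸ Finset.mem_insert_self _ _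
    exact (Finset.mem_insert.1 this).resolve_left fun h => hne (Prod.ext_iff.1 h).1.symm
  have h2 : (z, x) ∈ τ' := by
    have : (z, x) ∈ insert (z', x) τ' := heq ▸ Finset.mem_insert_self _ _
    exact (Finset.mem_insert.1 this).resolve_left fun h => hne (Prod.ext_iff.1 h).1
  -- Apart from the edge entering `z'`, all edges of `τ` lie in `τ'`. So a walk to `z` in `τ` either
  -- meets `z'` or is a walk in `τ'`; from `x` either alternative closes a cycle in a tree.
  have key : ∀ v, ReflTransGen (fun x y => (x, y) ∈ τ) v z →
      ReflTransGen (fun x y => (x, y) ∈ τ) v z' ∨ ReflTransGen (fun x y => (x, y) ∈ τ') v z := by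
    intro v hv
    induction hv using ReflTransGen.head_induction_on with
    | refl => exact .inr .refl
    | @head b c hbc _ ih =>
      by_cases hb : b = z'
      · subst hb; exact .inl .refl
      · have hbc' : (b, c) ∈ τ' := by
          have : (b, c) ∈ insert (z', x) τ' := heq ▸ Finset.mem_insert_of_mem hbc
          exact (Finset.mem_insert.1 this).resolve_left fun h => hb (Prod.ext_iff.1 h).1
        exact ih.imp (.head hbc) (.head hbc')
  rcases key x (h.spanning x hx) with h3 | h3
  · exact h.acyclic (h.edge _ h1).2.1 (TransGen.head' h1 h3)
  · exact h'.acyclic (h'.edge _ h2).2.1 (TransGen.head' h2 h3)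

/-- Edge sets on `R` with unique incoming edges such that every node of `R` is reached from `x` along
a non-trivial path. -/
structure IsUnicyclic (G : WeightedDigraph V) (R : Set V) (x : V) (σ : Finset (V × V)) : Prop where
  mem : x ∈ R
  edge : ∀ e ∈ σ, e ∈ G.E ∧ e.1 ∈ R ∧ e.2 ∈ R
  unique_incoming : ∀ e ∈ σ, ∀ e' ∈ σ, e.1 = e'.1 → e = e'
  spanning : ∀ v ∈ R, Relation.TransGen (fun x y => (x, y) ∈ σ) v x

lemma IsSpanningTree.insert_edge [DecidableEq V] {R : Set V} {τ : Finset (V × V)} {z y : V}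
    (h : G.IsSpanningTree R z τ) (hE : (z, y) ∈ G.E) (hy : y ∈ R) :
    (∀ e ∈ insert (z, y) τ, e ∈ G.E ∧ e.1 ∈ R ∧ e.2 ∈ R) ∧
      ∀ e ∈ insert (z, y) τ, ∀ e' ∈ insert (z, y) τ, e.1 = e'.1 → e = e' := by
  constructor
  · intro e he
    rcases Finset.mem_insert.1 he with rfl | he
    · exact ⟨hE, h.root_mem, hy⟩
    · exact h.edge e he
  · intro e he e' he' hee
    rcases Finset.mem_insert.1 he with rfl | he <;> rcases Finset.mem_insert.1 he' with rfl | he'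
    · rfl
    · exact absurd hee.symm (h.root _ he')
    · exact absurd hee (h.root _ he)
    · exact h.unique_incoming _ he _ he' hee

open Relation

lemma IsSpanningTree.spanning_insert [DecidableEq V] {R : Set V} {τ : Finset (V × V)} {z v : V}
    (h : G.IsSpanningTree R z τ) (e : V × V) (hv : v ∈ R) :
    ReflTransGen (fun x y => (x, y) ∈ insert e τ) v z :=
  ReflTransGen.mono (fun _ _ => Finset.mem_insert_of_mem) _ _ (h.spanning v hv)

/-- The cycle through `x` can be closed in two ways: here by the edge entering `x`, in
`IsSpanningTree.isUnicyclic'` by the edge of the cycle leaving `x`. Counting both ways yields the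
tree theorem. -/
lemma IsSpanningTree.isUnicyclic [DecidableEq V] {R : Set V} {τ : Finset (V × V)} {x y : V}
    (h : G.IsSpanningTree R x τ) (hE : (x, y) ∈ G.E) (hy : y ∈ R) :
    G.IsUnicyclic R x (insert (x, y) τ) where
  mem := h.root_mem
  edge := (h.insert_edge hE hy).1
  unique_incoming := (h.insert_edge hE hy).2
  spanning v hv := by
    rcases reflTransGen_iff_eq_or_transGen.1 (h.spanning_insert (x, y) hv) with rfl | h1
    · exact TransGen.head' (Finset.mem_insert_self _ _) (h.spanning_insert _ hy)
    · exact h1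

lemma IsSpanningTree.isUnicyclic' [DecidableEq V] {R : Set V} {τ : Finset (V × V)} {z x : V}
    (h : G.IsSpanningTree R z τ) (hE : (z, x) ∈ G.E) (hx : x ∈ R) :
    G.IsUnicyclic R x (insert (z, x) τ) where
  mem := hx
  edge := (h.insert_edge hE hx).1
  unique_incoming := (h.insert_edge hE hx).2
  spanning _ hv := TransGen.tail' (h.spanning_insert _ hv) (Finset.mem_insert_self _ _)

/-- A reach has a spanning tree with any given root. -/
lemma exists_isSpanningTree [Finite V] (hG : G.IsGraph) {R : G.Reach} {r : V}
    (hr : IsRoot R r) : ∃ τ, G.IsSpanningTree R.1 r τ := by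
  classical
  -- A largest subset carrying a tree rooted at `r` must be the whole reach: otherwise a path from
  -- `r` to a missing node leaves it, and the crossing edge can be added.
  obtain ⟨S, -, hS⟩ := (Set.toFinite {S : Set V | S ⊆ R.1 ∧ ∃ τ, G.IsSpanningTree S r τ}
    ).exists_le_maximal (a := {r}) ⟨by simpa using hr.mem, ∅, by
      refine ⟨rfl, by simp, by simp, by simp, ?_⟩
      rintro v rfl
      exact .refl⟩
  obtain ⟨⟨hSR, τ, hτ⟩, hmax⟩ := hS
  suffices h : S = R.1 from h ▸ ⟨τ, hτ⟩
  by_contra hne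
  obtain ⟨v, hvR, hvS⟩ := Set.exists_of_ssubset (hSR.ssubset_of_ne hne)
  have key : ∃ x y, x ∉ S ∧ y ∈ S ∧ (x, y) ∈ G.E := by
    have hs := hr.sees hvR
    clear hvR
    induction hs using ReflTransGen.head_induction_on with
    | refl => exact absurd hτ.root_mem hvS
    | @head b c hbc _ ih =>
      by_cases hc : c ∈ S
      · exact ⟨b, c, hvS, hc, hbc.1⟩
      · exact ih hc
  obtain ⟨x, y, hx, hy, hxy⟩ := key
  have hxτ : ∀ e ∈ τ, e.1 ≠ x := fun e he h => hx (h ▸ (hτ.edge e he).2.1)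
  refine hx (hmax (y := insert x S) ⟨Set.insert_subset
    (R.mem_of_sees (hSR hy) (hG.sees_of_mem hxy)) hSR, insert (x, y) τ, ?_⟩
    (Set.subset_insert x S) (Set.mem_insert x S))
  have hmono : ∀ v ∈ S, ReflTransGen (fun a b => (a, b) ∈ insert (x, y) τ) v r :=
    fun v hv => hτ.spanning_insert _ hv
  refine ⟨Or.inr hτ.root_mem, ?_, ?_, ?_, ?_⟩
  · intro e he
    rcases Finset.mem_insert.1 he with rfl | he
    · exact ⟨hxy, Or.inl rfl, Or.inr hy⟩
    · exact ⟨(hτ.edge e he).1, Or.inr (hτ.edge e he).2.1, Or.inr (hτ.edge e he).2.2⟩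
  · intro e he
    rcases Finset.mem_insert.1 he with rfl | he
    · exact fun h => hx (by rw [show x = r from h]; exact hτ.root_mem)
    · exact hτ.root e he
  · intro e he e' he' hee
    rcases Finset.mem_insert.1 he with rfl | he <;> rcases Finset.mem_insert.1 he' with rfl | he'
    · rfl
    · exact absurd hee.symm (hxτ e' he')
    · exact absurd hee (hxτ e he)
    · exact hτ.unique_incoming _ he _ he' hee
  · rintro v (rfl | hv)
    · exact .head (Finset.mem_insert_self _ _) (hmono y hy)
    · exact hmono v hv

/-! ### The left kernel vectors -/

lemma weightVec_nonneg [Fintype V] (hG : G.IsGraph) (R : Set V) (i : V) : 0 ≤ G.weightVec R i :=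
  Finset.sum_nonneg fun _ _ => Finset.prod_nonneg fun e _ => hG.a_nonneg e.1 e.2

lemma IsSpanningTree.isRoot {R : G.Reach} {τ : Finset (V × V)} {z : V}
    (h : G.IsSpanningTree R.1 z τ) (hG : G.IsGraph) : IsRoot R z :=
  isRoot_of_sees R fun v hv => ReflTransGen.mono
    (fun x y hxy => ⟨(h.edge _ hxy).1, ((hG.mem_E x y).1 (h.edge _ hxy).1).ne'⟩) _ _
    (h.spanning v hv)

variable [Fintype V]

lemma weightVec_eq_zero (hG : G.IsGraph) {R : G.Reach} {i : V} (h : ¬ IsRoot R i) :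
    G.weightVec R.1 i = 0 := by
  classical
  refine Finset.sum_eq_zero fun τ hτ => ?_
  exact absurd ((Finset.mem_filter.1 hτ).2.isRoot hG) h

lemma weightVec_pos (hG : G.IsGraph) {R : G.Reach} {r : V} (hr : IsRoot R r) :
    0 < G.weightVec R.1 r := by
  classical
  obtain ⟨τ, hτ⟩ := exists_isSpanningTree hG hr
  refine Finset.sum_pos' (fun _ _ => Finset.prod_nonneg fun e _ => hG.a_nonneg e.1 e.2)
    ⟨τ, by simpa using hτ, Finset.prod_pos fun e he => (hG.mem_E e.1 e.2).1 (hτ.edge e he).1⟩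

open Classical in
-- Adding an edge into the root `x` is a bijection from pairs of a tree and such an edge; its
-- inverse deletes the only edge of `σ` entering `x`.
lemma weightVec_mul_sum (hG : G.IsGraph) (R : G.Reach) (x : V) :
    G.weightVec R.1 x * ∑ y, G.a x y =
      ∑ σ : Finset (V × V) with G.IsUnicyclic R.1 x σ, ∏ e ∈ σ, G.a e.1 e.2 := by
  have h1 : G.weightVec R.1 x * ∑ y, G.a x y =
      ∑ p : Finset (V × V) × V with G.IsSpanningTree R.1 x p.1 ∧ (x, p.2) ∈ G.E,
        G.a x p.2 * ∏ e ∈ p.1, G.a e.1 e.2 := by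
    rw [Finset.sum_filter, Fintype.sum_prod_type, weightVec, Finset.sum_mul, Finset.sum_filter]
    refine Finset.sum_congr rfl fun τ _ => ?_
    split_ifs with hτ
    · rw [Finset.mul_sum]
      refine Finset.sum_congr rfl fun y _ => ?_
      by_cases hy : (x, y) ∈ G.E
      · simp [hτ, hy, mul_comm]
      · simp [hy, hG.a_eq_zero hy]
    · simp [hτ]
  rw [h1]
  have hmem : ∀ p : Finset (V × V) × V, G.IsSpanningTree R.1 x p.1 → (x, p.2) ∈ G.E →
      p.2 ∈ R.1 := fun p hp hE => ((hp.isRoot hG).of_sees (hG.sees_of_mem hE)).mem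
  refine Finset.sum_bij (fun p _ => insert (x, p.2) p.1) ?_ ?_ ?_ ?_
  · intro p hp
    obtain ⟨hp, hE⟩ := (Finset.mem_filter.1 hp).2
    simpa using hp.isUnicyclic hE (hmem p hp hE)
  · intro p hp q hq h
    have := (Finset.mem_filter.1 hp).2.1.insert_inj (Finset.mem_filter.1 hq).2.1 h
    exact Prod.ext this.1 this.2
  · intro σ hσ
    have hσ := (Finset.mem_filter.1 hσ).2
    obtain ⟨y, hy, -⟩ := TransGen.head'_iff.1 (hσ.spanning x hσ.mem)
    refine ⟨(σ.erase (x, y), y), ?_, Finset.insert_erase hy⟩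
    simpa using ⟨isSpanningTree_erase hσ.edge hσ.unique_incoming hy
      fun v hv => (hσ.spanning v hv).to_reflTransGen, (hσ.edge _ hy).1⟩
  · intro p hp
    rw [Finset.prod_insert (Finset.mem_filter.1 hp).2.1.notMem]

open Classical in
-- The inverse bijection deletes the edge leaving `x` on the cycle. Several edges of `σ` may leave
-- `x`; that only one deletion gives a tree is `IsSpanningTree.insert_inj_root`.
lemma sum_weightVec_mul (hG : G.IsGraph) (R : G.Reach) (x : V) :
    ∑ z, G.weightVec R.1 z * G.a z x =
      ∑ σ : Finset (V × V) with G.IsUnicyclic R.1 x σ, ∏ e ∈ σ, G.a e.1 e.2 := by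
  have h1 : ∑ z, G.weightVec R.1 z * G.a z x =
      ∑ p : V × Finset (V × V) with G.IsSpanningTree R.1 p.1 p.2 ∧ (p.1, x) ∈ G.E,
        G.a p.1 x * ∏ e ∈ p.2, G.a e.1 e.2 := by
    rw [Finset.sum_filter, Fintype.sum_prod_type]
    refine Finset.sum_congr rfl fun z _ => ?_
    rw [weightVec, Finset.sum_mul, Finset.sum_filter]
    refine Finset.sum_congr rfl fun τ _ => ?_
    by_cases hz : (z, x) ∈ G.E
    · simp [hz, mul_comm]
    · simp [hz, hG.a_eq_zero hz]
  rw [h1]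
  have hmem : ∀ p : V × Finset (V × V), G.IsSpanningTree R.1 p.1 p.2 → (p.1, x) ∈ G.E →
      x ∈ R.1 := fun p hp hE => ((hp.isRoot hG).of_sees (hG.sees_of_mem hE)).mem
  refine Finset.sum_bij (fun p _ => insert (p.1, x) p.2) ?_ ?_ ?_ ?_
  · intro p hp
    obtain ⟨hp, hE⟩ := (Finset.mem_filter.1 hp).2
    simpa using hp.isUnicyclic' hE (hmem p hp hE)
  · intro p hp q hq h
    obtain ⟨hp, hE⟩ := (Finset.mem_filter.1 hp).2
    have := hp.insert_inj_root (Finset.mem_filter.1 hq).2.1 (hmem p hp hE) h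
    exact Prod.ext this.1 this.2
  · intro σ hσ
    have hσ := (Finset.mem_filter.1 hσ).2
    obtain ⟨z, hxz, hz⟩ := TransGen.tail'_iff.1 (hσ.spanning x hσ.mem)
    refine ⟨(z, σ.erase (z, x)), ?_, Finset.insert_erase hz⟩
    simpa using ⟨isSpanningTree_erase hσ.edge hσ.unique_incoming hz
      fun v hv => (hσ.spanning v hv).to_reflTransGen.trans hxz, (hσ.edge _ hz).1⟩
  · intro p hp
    rw [Finset.prod_insert (Finset.mem_filter.1 hp).2.1.notMem]

/-- The Markov chain tree theorem. -/
theorem weightVec_balance (hG : G.IsGraph) (R : G.Reach) (x : V) :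
    G.weightVec R.1 x * ∑ y, G.a x y = ∑ z, G.weightVec R.1 z * G.a z x :=
  (weightVec_mul_sum hG R x).trans (sum_weightVec_mul hG R x).symm

lemma sum_weightVec_mul_mass_pos (hG : G.IsGraph) (R : G.Reach) :
    0 < ∑ i, G.weightVec R.1 i * G.m i := by
  obtain ⟨r, hr⟩ := exists_isRoot R
  exact Finset.sum_pos' (fun i _ => mul_nonneg (weightVec_nonneg hG _ i) (hG.m_pos i).le)
    ⟨r, Finset.mem_univ r, mul_pos (weightVec_pos hG hr) (hG.m_pos r)⟩

lemma leftVec_nonneg (hG : G.IsGraph) (R : G.Reach) (x : V) : 0 ≤ G.leftVec R x :=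
  div_nonneg (weightVec_nonneg hG _ x) (sum_weightVec_mul_mass_pos hG R).le

lemma leftVec_eq_zero (hG : G.IsGraph) {R : G.Reach} {x : V} (h : ¬ IsRoot R x) :
    G.leftVec R x = 0 := by
  rw [leftVec, weightVec_eq_zero hG h, zero_div]

lemma sum_leftVec_mul_mass (hG : G.IsGraph) (R : G.Reach) : ∑ x, G.leftVec R x * G.m x = 1 := by
  simp only [leftVec, div_mul_eq_mul_div, ← Finset.sum_div]
  exact div_self (sum_weightVec_mul_mass_pos hG R).ne'

lemma leftVec_balance (hG : G.IsGraph) (R : G.Reach) (x : V) :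
    G.leftVec R x * ∑ y, G.a x y = ∑ z, G.leftVec R z * G.a z x := by
  simp only [leftVec, div_mul_eq_mul_div, ← Finset.sum_div]
  rw [weightVec_balance hG]

end WeightedDigraph

/-! ### Contraction semigroups with a large parameter -/

section Semigroup

open Filter Topology NormedSpace

lemma hasSum_pow_div_factorial (l : ℝ) :
    HasSum (fun n : ℕ => l ^ n / n.factorial) (Real.exp l) := by
  rw [Real.exp_eq_exp_ℝ]
  exact expSeries_div_hasSum_exp l

lemma hasSum_mul_pow_div_factorial (l : ℝ) :
    HasSum (fun n : ℕ => (n : ℝ) * (l ^ n / n.factorial)) (l * Real.exp l) := by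
  rw [← hasSum_nat_add_iff' 1]
  simp only [Finset.range_one, Finset.sum_singleton, Nat.cast_zero, zero_mul, sub_zero]
  refine ((hasSum_pow_div_factorial l).mul_left l).congr_fun fun n => ?_
  rw [Nat.factorial_succ, pow_succ]
  push_cast
  field_simp

lemma hasSum_sq_mul_pow_div_factorial (l : ℝ) :
    HasSum (fun n : ℕ => (n : ℝ) ^ 2 * (l ^ n / n.factorial)) ((l ^ 2 + l) * Real.exp l) := by
  rw [← hasSum_nat_add_iff' 1]
  simp only [Finset.range_one, Finset.sum_singleton, Nat.cast_zero, ne_eq, OfNat.ofNat_ne_zero,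
    not_false_eq_true, zero_pow, zero_mul, sub_zero]
  have := ((hasSum_mul_pow_div_factorial l).mul_left l).add
    ((hasSum_pow_div_factorial l).mul_left l)
  rw [show l * (l * Real.exp l) + l * Real.exp l = (l ^ 2 + l) * Real.exp l by ring] at this
  refine this.congr_fun fun n => ?_
  rw [Nat.factorial_succ, pow_succ]
  push_cast
  field_simp
  ring

variable {𝔸 : Type*} [NormedRing 𝔸] [NormedAlgebra ℂ 𝔸] [CompleteSpace 𝔸]

lemma hasSum_exp_smul (K : 𝔸) (l : ℝ) :
    HasSum (fun n : ℕ => ((l ^ n / n.factorial : ℝ) : ℂ) • K ^ n) (exp ((l : ℂ) • K)) := by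
  refine (exp_series_hasSum_exp' (𝕂 := ℂ) ((l : ℂ) • K)).congr_fun fun n => ?_
  rw [smul_pow, smul_smul]
  push_cast
  rw [div_eq_inv_mul]

lemma norm_exp_smul_le {K : 𝔸} (hK : ∀ n : ℕ, ‖K ^ n‖ ≤ 1) {l : ℝ} (hl : 0 ≤ l) :
    ‖exp ((l : ℂ) • K)‖ ≤ Real.exp l := by
  refine (hasSum_exp_smul K l).norm_le_of_bounded (hasSum_pow_div_factorial l) fun n => ?_
  rw [norm_smul, Complex.norm_real, Real.norm_of_nonneg (by positivity)]
  exact mul_le_of_le_one_right (by positivity) (hK n)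

/-- The second moment of a Poisson variable. -/
lemma hasSum_poisson_bound {l d : ℝ} (hl : 0 < l) (hd : 0 < d) :
    HasSum (fun n : ℕ => (d + (1 - n / l) ^ 2 / d) / 2 * (l ^ n / n.factorial))
      ((d + 1 / (l * d)) / 2 * Real.exp l) := by
  have := (((hasSum_pow_div_factorial l).mul_left ((d + 1 / d) / 2)).add
    ((hasSum_mul_pow_div_factorial l).mul_left (-1 / (l * d)))).add
    ((hasSum_sq_mul_pow_div_factorial l).mul_left (1 / (2 * d * l ^ 2)))
  have h : (d + 1 / d) / 2 * Real.exp l + -1 / (l * d) * (l * Real.exp l) +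
      1 / (2 * d * l ^ 2) * ((l ^ 2 + l) * Real.exp l) =
      (d + 1 / (l * d)) / 2 * Real.exp l := by
    field_simp
    ring
  rw [h] at this
  refine this.congr_fun fun n => ?_
  generalize l ^ n / (n.factorial : ℝ) = q
  field_simp
  ring

/-- The Poisson estimate for a power bounded element. -/
lemma norm_one_sub_mul_exp_smul_le {K : 𝔸} (hK : ∀ n : ℕ, ‖K ^ n‖ ≤ 1) {l : ℝ} (hl : 0 < l) :
    ‖(1 - K) * exp ((l : ℂ) • K)‖ ≤ (√l)⁻¹ * Real.exp l := by
  have h1 := hasSum_exp_smul K l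
  -- Multiplication by `K` shifts the index, which multiplies the Poisson weight of `K ^ n` by `n /
  -- l`. So `1 - K` produces the factor `1 - n / l`, the relative deviation of a Poisson variable
  -- from its mean.
  have h2 : HasSum (fun n : ℕ => ((n / l * (l ^ n / n.factorial) : ℝ) : ℂ) • K ^ n)
      (K * exp ((l : ℂ) • K)) := by
    rw [← hasSum_nat_add_iff' 1]
    simp only [Finset.range_one, Finset.sum_singleton, Nat.cast_zero, zero_div, zero_mul,
      Complex.ofReal_zero, zero_smul, sub_zero]
    refine (h1.mul_left K).congr_fun fun n => ?_
    rw [mul_smul_comm, ← pow_succ']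
    congr 2
    rw [Nat.factorial_succ, pow_succ]
    push_cast
    field_simp
  have h3 := h1.sub h2
  rw [← one_sub_mul] at h3
  -- This is the standard deviation of `n / l`, which minimises the bound `(d + 1 / (l * d)) / 2`.
  -- Below, `|1 - n / l|` is bounded by `(d + (1 - n / l) ^ 2 / d) / 2`, so second moments suffice.
  have hd : 0 < (√l)⁻¹ := by positivity
  set d := (√l)⁻¹ with hd_def
  have h4 := hasSum_poisson_bound hl hd
  have hld : 1 / (l * d) = d := by
    rw [hd_def]
    nth_rewrite 1 [← Real.mul_self_sqrt hl.le]
    field_simp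
  rw [hld, add_self_div_two] at h4
  refine h3.norm_le_of_bounded h4 fun n => ?_
  rw [← sub_smul, ← Complex.ofReal_sub, ← one_sub_mul, norm_smul, Complex.norm_real, norm_mul,
    Real.norm_of_nonneg (show 0 ≤ l ^ n / n.factorial by positivity)]
  refine (mul_le_of_le_one_right (by positivity) (hK n)).trans ?_
  gcongr
  rw [Real.norm_eq_abs, le_div_iff₀ two_pos, ← sq_abs]
  set w := |1 - n / l|
  have : d + w ^ 2 / d - w * 2 = (d - w) ^ 2 / d := by field_simp; ring
  have h5 : 0 ≤ (d - w) ^ 2 / d := by positivity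
  linarith

lemma exp_neg_smul_one_sub (K : 𝔸) (l : ℝ) :
    exp (-(l : ℂ) • (1 - K)) = ((Real.exp (-l) : ℝ) : ℂ) • exp ((l : ℂ) • K) := by
  let _ : NormedAlgebra ℚ 𝔸 := NormedAlgebra.restrictScalars ℚ ℂ 𝔸
  have h : -(l : ℂ) • (1 - K) = algebraMap ℂ 𝔸 (-(l : ℂ)) + (l : ℂ) • K := by
    rw [Algebra.algebraMap_eq_smul_one]
    module
  rw [h, exp_add_of_commute (Algebra.commutes _ _), ← algebraMap_exp_comm, ← Complex.exp_eq_exp_ℂ,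
    Algebra.algebraMap_eq_smul_one, smul_mul_assoc, one_mul]
  push_cast
  rfl

lemma norm_exp_neg_smul_one_sub_le {K : 𝔸} (hK : ∀ n : ℕ, ‖K ^ n‖ ≤ 1) {l : ℝ} (hl : 0 ≤ l) :
    ‖exp (-(l : ℂ) • (1 - K))‖ ≤ 1 := by
  rw [exp_neg_smul_one_sub, norm_smul, Complex.norm_real, Real.norm_of_nonneg (Real.exp_pos _).le]
  calc _ ≤ Real.exp (-l) * Real.exp l := by gcongr; exact norm_exp_smul_le hK hl
    _ = 1 := by rw [← Real.exp_add]; simp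

lemma norm_one_sub_mul_exp_neg_smul_le {K : 𝔸} (hK : ∀ n : ℕ, ‖K ^ n‖ ≤ 1) {l : ℝ} (hl : 0 < l) :
    ‖(1 - K) * exp (-(l : ℂ) • (1 - K))‖ ≤ (√l)⁻¹ := by
  rw [exp_neg_smul_one_sub, mul_smul_comm, norm_smul, Complex.norm_real,
    Real.norm_of_nonneg (Real.exp_pos _).le]
  calc _ ≤ Real.exp (-l) * ((√l)⁻¹ * Real.exp l) := by
        gcongr; exact norm_one_sub_mul_exp_smul_le hK hl
    _ = (√l)⁻¹ * (Real.exp (-l) * Real.exp l) := by ring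
    _ = _ := by rw [← Real.exp_add]; simp

variable {E F : Type*} [NormedAddCommGroup E] [NormedSpace ℂ E] [NormedAddCommGroup F]
  [NormedSpace ℂ F]

lemma ContinuousLinearMap.norm_pow_le_one {K : E →L[ℂ] E} (hK : ‖K‖ ≤ 1) (n : ℕ) :
    ‖K ^ n‖ ≤ 1 := by
  induction n with
  | zero => exact ContinuousLinearMap.norm_id_le
  | succ n ih =>
    rw [pow_succ]
    exact (norm_mul_le _ _).trans (mul_le_one₀ ih (norm_nonneg _) hK)

/-- A sum of multiples of generators `1 - K` with `K` a contraction has this form again. -/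
lemma exists_contraction {KA KB : E →L[ℂ] E} (hKA : ‖KA‖ ≤ 1) (hKB : ‖KB‖ ≤ 1) {c β : ℝ}
    (hβ : 0 ≤ β) : ∃ K : E →L[ℂ] E, ‖K‖ ≤ 1 ∧
      (c : ℂ) • (1 - KA) + (β : ℂ) • (c : ℂ) • (1 - KB) = ((c * (1 + β) : ℝ) : ℂ) • (1 - K) := by
  have h1 : 0 < 1 + β := by linarith
  have h2 : ((1 + β : ℝ) : ℂ) ≠ 0 := Complex.ofReal_ne_zero.2 h1.ne'
  -- The weighted mean of the two contractions.
  refine ⟨((1 + β : ℝ) : ℂ)⁻¹ • (KA + (β : ℂ) • KB), ?_, ?_⟩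
  · rw [norm_smul, norm_inv, Complex.norm_real, Real.norm_of_nonneg h1.le, inv_mul_le_iff₀ h1,
      mul_one]
    refine (norm_add_le _ _).trans (add_le_add hKA ?_)
    rw [norm_smul, Complex.norm_real, Real.norm_of_nonneg hβ]
    exact mul_le_of_le_one_right hβ hKB
  · rw [Complex.ofReal_mul, mul_smul, smul_sub ((1 + β : ℝ) : ℂ), smul_inv_smul₀ h2]
    push_cast
    module

variable [CompleteSpace E] [CompleteSpace F]

/-- Duhamel's estimate for an approximate intertwiner. -/
lemma norm_exp_comp_sub_comp_exp_le {L : E →L[ℂ] E} {N : F →L[ℂ] F} {W : F →L[ℂ] E} {t C M : ℝ}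
    (ht : 0 ≤ t) (hL : ∀ s : ℝ, 0 ≤ s → ‖exp (-(s : ℂ) • L)‖ ≤ 1)
    (hN : ∀ s ∈ Set.Icc 0 t, ‖exp (-(s : ℂ) • N)‖ ≤ M) (hW : ‖L ∘L W - W ∘L N‖ ≤ C) :
    ‖exp (-(t : ℂ) • L) ∘L W - W ∘L exp (-(t : ℂ) • N)‖ ≤ C * M * t := by
  have hC : 0 ≤ C := (norm_nonneg _).trans hW
  -- `φ` runs from `exp (-t • L) ∘L W` at `0` to `W ∘L exp (-t • N)` at `t`; its derivative contains
  -- the intertwining defect of `W`.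
  let φ : ℂ → F →L[ℂ] E := fun z => exp ((z - t) • L) ∘L (W ∘L exp (z • (-N)))
  have hφ : ∀ s : ℝ, HasDerivAt (fun s : ℝ => φ s)
      (exp (((s : ℂ) - t) • L) ∘L ((L ∘L W - W ∘L N) ∘L exp ((s : ℂ) • (-N)))) s := by
    intro s
    have h1 : HasDerivAt (fun z : ℂ => exp ((z - t) • L)) (exp (((s : ℂ) - t) • L) * L) (s : ℂ) :=
      (hasDerivAt_exp_smul_const L ((s : ℂ) - t)).comp_sub_const (s : ℂ) (t : ℂ)
    have h2 := hasDerivAt_exp_smul_const' (-N) (s : ℂ)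
    have h3 := h1.clm_comp ((hasDerivAt_const (s : ℂ) W).clm_comp h2)
    refine (h3.scomp s Complex.ofRealCLM.hasDerivAt).congr_deriv ?_
    ext x
    simp [sub_eq_add_neg]
  have key := norm_image_sub_le_of_norm_deriv_le_segment' (f := fun s : ℝ => φ s) (a := 0) (b := t)
    (C := C * M) (fun s _ => (hφ s).hasDerivWithinAt) (fun s hs => ?_) t ⟨ht, le_rfl⟩
  · rw [sub_zero, norm_sub_rev] at key
    have h1 : φ t = W ∘L exp (-(t : ℂ) • N) := by
      simp only [φ, sub_self, zero_smul, exp_zero, smul_neg, neg_smul]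
      rfl
    have h2 : φ (0 : ℝ) = exp (-(t : ℂ) • L) ∘L W := by
      simp only [φ, Complex.ofReal_zero, zero_sub, zero_smul, exp_zero]
      rfl
    rwa [h1, h2] at key
  · have h1 := hL (t - s) (by linarith [hs.2])
    rw [show -((t - s : ℝ) : ℂ) = (s : ℂ) - t by push_cast; ring] at h1
    have h2 := hN s ⟨hs.1, hs.2.le⟩
    rw [neg_smul, ← smul_neg] at h2
    calc _ ≤ ‖exp (((s : ℂ) - t) • L)‖ * (‖L ∘L W - W ∘L N‖ * ‖exp ((s : ℂ) • (-N))‖) :=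
          (ContinuousLinearMap.opNorm_comp_le _ _).trans
            (mul_le_mul_of_nonneg_left (ContinuousLinearMap.opNorm_comp_le _ _) (norm_nonneg _))
      _ ≤ 1 * (C * M) := by gcongr
      _ = C * M := one_mul _

/-- Convergence of the semigroups generated by `-(A + βB)` as `β → ∞`, for generators `A` and `B` of
contraction semigroups with bounded generators and a projection `J ∘ J'` onto the kernel of `B`. -/
theorem tendsto_exp_add_smul {A B Bs KA KB : E →L[ℂ] E} {J : F →L[ℂ] E} {J' : E →L[ℂ] F}
    {N : F →L[ℂ] F} {c t : ℝ} (hc : 0 < c) (ht : 0 < t) (hKA : ‖KA‖ ≤ 1) (hKB : ‖KB‖ ≤ 1)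
    (hA : A = (c : ℂ) • (1 - KA)) (hB : B = (c : ℂ) • (1 - KB)) (hBJ : B ∘L J = 0)
    (hQ : B ∘L Bs = 1 - J ∘L J') (hN : N = J' ∘L A ∘L J) :
    Tendsto (fun β : ℝ => exp (-(t : ℂ) • (A + (β : ℂ) • B)) - J ∘L exp (-(t : ℂ) • N) ∘L J')
      atTop (𝓝 0) := by
  -- The operator `N` is not assumed to generate contractions; a bound on `[0, t]` independent of
  -- `β` is enough.
  obtain ⟨M, hM⟩ := (isCompact_Icc (a := (0 : ℝ)) (b := t)).exists_bound_of_continuousOn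
    (f := fun s : ℝ => exp (-(s : ℂ) • N)) (by
      let _ : NormedAlgebra ℚ (F →L[ℂ] F) := NormedAlgebra.restrictScalars ℚ ℂ _
      exact (exp_continuous.comp (by fun_prop)).continuousOn)
  -- First-order corrector: `B ∘L X = A ∘L J - J ∘L N` is exactly the defect of `J` as an
  -- intertwiner.
  set X : F →L[ℂ] E := Bs ∘L A ∘L J with hX
  set D : F →L[ℂ] E := X ∘L N - A ∘L X with hD
  set e := exp (-(t : ℂ) • N) with he
  set C₁ := (‖D‖ * M * t + ‖X‖ + ‖X‖ * ‖e‖) * ‖J'‖ with hC₁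
  set C₂ := (√(2 * c / t) + ‖A‖) * ‖Bs‖ with hC₂
  have hlim : Tendsto (fun β : ℝ => C₁ * β⁻¹ + C₂ * (√β)⁻¹) atTop (𝓝 0) := by
    have h1 : Tendsto (fun β : ℝ => (√β)⁻¹) atTop (𝓝 0) :=
      tendsto_inv_atTop_zero.comp Real.tendsto_sqrt_atTop
    simpa using (tendsto_inv_atTop_zero.const_mul C₁).add (h1.const_mul C₂)
  refine squeeze_zero_norm' ?_ hlim
  filter_upwards [eventually_ge_atTop 1] with β hβ
  have hβ0 : 0 < β := by linarith
  have hβc : (β : ℂ) ≠ 0 := Complex.ofReal_ne_zero.2 hβ0.ne'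
  set L := A + (β : ℂ) • B with hL
  obtain ⟨K, hK, hLK⟩ := exists_contraction hKA hKB (c := c) hβ0.le
  rw [← hA, ← hB, ← hL] at hLK
  have hKn := ContinuousLinearMap.norm_pow_le_one hK
  have hs : ∀ s : ℝ, -(s : ℂ) • L = -((s * (c * (1 + β)) : ℝ) : ℂ) • (1 - K) := fun s => by
    rw [hLK, smul_smul]; push_cast; rw [neg_mul]
  have hcontr : ∀ s : ℝ, 0 ≤ s → ‖exp (-(s : ℂ) • L)‖ ≤ 1 := fun s hs0 => by
    rw [hs]
    exact norm_exp_neg_smul_one_sub_le hKn (by positivity)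
  set T := exp (-(t : ℂ) • L) with hT
  have hT1 : ‖T‖ ≤ 1 := hcontr t ht.le
  have hβn : ‖(β : ℂ)⁻¹‖ = β⁻¹ := by
    rw [norm_inv, Complex.norm_real, Real.norm_of_nonneg hβ0.le]
  have hsq : 1 ≤ √β := by rwa [Real.one_le_sqrt]
  -- the part off the kernel
  have hTL : ‖T * L‖ ≤ √(2 * c / t) * √β := by
    have h1 : T * L = ((c * (1 + β) : ℝ) : ℂ) •
        ((1 - K) * exp (-((t * (c * (1 + β)) : ℝ) : ℂ) • (1 - K))) := by
      rw [hT, hs, hLK, mul_smul_comm]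
      congr 1
      let _ : NormedAlgebra ℚ (E →L[ℂ] E) := NormedAlgebra.restrictScalars ℚ ℂ _
      exact ((Commute.refl (1 - K)).smul_left _).exp_left
    have hpos : 0 < c * (1 + β) := by positivity
    rw [h1, norm_smul, Complex.norm_real, Real.norm_of_nonneg hpos.le]
    calc _ ≤ c * (1 + β) * (√(t * (c * (1 + β))))⁻¹ := by
          gcongr; exact norm_one_sub_mul_exp_neg_smul_le hKn (by positivity)
      _ = √(c * (1 + β) / t) := by
          rw [Real.sqrt_mul ht.le, Real.sqrt_div hpos.le]
          nth_rewrite 1 [← Real.mul_self_sqrt hpos.le]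
          field_simp
      -- Here `1 + β ≤ 2 * β`, as `β ≥ 1`.
      _ ≤ √(2 * c / t * β) := by
          apply Real.sqrt_le_sqrt
          rw [div_mul_eq_mul_div]
          exact div_le_div_of_nonneg_right (by nlinarith) ht.le
      _ = _ := Real.sqrt_mul (by positivity) β
  have hTB : ‖T ∘L B‖ ≤ (√(2 * c / t) + ‖A‖) * (√β)⁻¹ := by
    have h1 : T ∘L B = (β : ℂ)⁻¹ • (T * L - T * A) := by
      rw [hL, mul_add, add_sub_cancel_left, mul_smul_comm, inv_smul_smul₀ hβc]
      rfl
    rw [h1, norm_smul, hβn]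
    have h2 : ‖T * A‖ ≤ ‖A‖ * √β :=
      (norm_mul_le _ _).trans ((mul_le_of_le_one_left (norm_nonneg _) hT1).trans
        (le_mul_of_one_le_right (norm_nonneg _) hsq))
    calc _ ≤ β⁻¹ * (√(2 * c / t) * √β + ‖A‖ * √β) := by
          gcongr
          exact (norm_sub_le _ _).trans (add_le_add hTL h2)
      _ = _ := by
          nth_rewrite 1 [← Real.mul_self_sqrt hβ0.le]
          field_simp
  -- the part on the kernel
  set W : F →L[ℂ] E := J - (β : ℂ)⁻¹ • X with hW
  -- The term of order `β` vanishes since `B ∘L J = 0`, and the one of order `1` by the choice of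
  -- `X`.
  have hLW : L ∘L W - W ∘L N = (β : ℂ)⁻¹ • D := by
    ext x
    have h1 : ∀ y, B (J y) = 0 := fun y => DFunLike.congr_fun hBJ y
    have h2 : ∀ y, B (Bs y) = y - J (J' y) := fun y => DFunLike.congr_fun hQ y
    simp only [hL, hW, hD, hX, hN, _root_.sub_apply, ContinuousLinearMap.comp_apply,
      _root_.add_apply, _root_.smul_apply, map_sub, map_smul, h1, h2,
      smul_sub, smul_add, inv_smul_smul₀ hβc, smul_zero]
    abel
  have hI := norm_exp_comp_sub_comp_exp_le (C := β⁻¹ * ‖D‖) ht.le hcontr hM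
    (by rw [hLW, norm_smul, hβn])
  rw [← hT, ← he] at hI
  -- Insert `1 = J ∘L J' + B ∘L Bs` to the right of `T`, and replace `J` by `W + β⁻¹ • X`.
  have hsplit : T - J ∘L e ∘L J' = (T ∘L W - W ∘L e) ∘L J' +
      (β : ℂ)⁻¹ • ((T ∘L X) ∘L J' - (X ∘L e) ∘L J') + (T ∘L B) ∘L Bs := by
    rw [ContinuousLinearMap.comp_assoc T B Bs, hQ]
    ext x
    simp only [hW, _root_.sub_apply, ContinuousLinearMap.comp_apply,
      _root_.add_apply, _root_.smul_apply, map_sub, map_smul,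
      one_apply_eq_self, smul_sub]
    abel
  have hTX : ‖T ∘L X‖ ≤ ‖X‖ := (ContinuousLinearMap.opNorm_comp_le _ _).trans
    (mul_le_of_le_one_left (norm_nonneg _) hT1)
  rw [hsplit]
  calc _ ≤ ‖T ∘L W - W ∘L e‖ * ‖J'‖ +
        β⁻¹ * (‖T ∘L X‖ * ‖J'‖ + ‖X‖ * ‖e‖ * ‖J'‖) + ‖T ∘L B‖ * ‖Bs‖ := by
        refine norm_add_le_of_le (norm_add_le_of_le (ContinuousLinearMap.opNorm_comp_le _ _) ?_)
          (ContinuousLinearMap.opNorm_comp_le _ _)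
        rw [norm_smul, hβn]
        gcongr
        refine norm_sub_le_of_le (ContinuousLinearMap.opNorm_comp_le _ _)
          ((ContinuousLinearMap.opNorm_comp_le _ _).trans ?_)
        gcongr
        exact ContinuousLinearMap.opNorm_comp_le _ _
    _ ≤ β⁻¹ * ‖D‖ * M * t * ‖J'‖ +
        β⁻¹ * (‖X‖ * ‖J'‖ + ‖X‖ * ‖e‖ * ‖J'‖) +
        (√(2 * c / t) + ‖A‖) * (√β)⁻¹ * ‖Bs‖ := by gcongr
    _ = _ := by rw [hC₁, hC₂]; ring

end Semigroup

/-! ### The Riesz projection at a semisimple eigenvalue -/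

section Riesz

open Filter Topology

/-- The resolvent near a semisimple eigenvalue `0` with spectral projection `P`. -/
lemma resolvent_eq_of_isIdempotent {𝔸 : Type*} [Ring 𝔸] [Algebra ℂ 𝔸] {L P : 𝔸} (hLP : L * P = 0)
    (hPL : P * L = 0) (hP : P * P = P) {z : ℂ} (hz : z ≠ 0) (hz' : z ∈ resolventSet ℂ (L + P)) :
    resolvent L z = z⁻¹ • P + resolvent (L + P) z * (1 - P) := by
  set a := algebraMap ℂ 𝔸 z - (L + P) with ha
  have hu : IsUnit a := hz'
  set r := resolvent (L + P) z with hr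
  have har : a * r = 1 := Ring.mul_inverse_cancel _ hu
  have hra : r * a = 1 := Ring.inverse_mul_cancel _ hu
  have hzP : ∀ x : 𝔸, algebraMap ℂ 𝔸 z * x = z • x := fun x => (Algebra.smul_def z x).symm
  have hPz : ∀ x : 𝔸, x * algebraMap ℂ 𝔸 z = z • x := fun x => by
    rw [← Algebra.commutes, hzP]
  have haP : a * P = P * a := by
    rw [ha, sub_mul, mul_sub, hzP, hPz, add_mul, mul_add, hLP, hPL]
  have hrP : r * P = P * r := by
    calc r * P = r * P * (a * r) := by rw [har, mul_one]
      _ = r * (P * a) * r := by simp only [mul_assoc]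
      _ = r * a * P * r := by rw [← haP]; simp only [mul_assoc]
      _ = P * r := by rw [hra, one_mul]
  have hPQ : P * (1 - P) = 0 := by rw [mul_sub, mul_one, hP, sub_self]
  have hQP : (1 - P) * P = 0 := by rw [sub_mul, one_mul, hP, sub_self]
  have haL : algebraMap ℂ 𝔸 z - L = a + P := by rw [ha]; abel
  have hzLP : (algebraMap ℂ 𝔸 z - L) * P = z • P := by rw [sub_mul, hzP, hLP, sub_zero]
  have hzPL : P * (algebraMap ℂ 𝔸 z - L) = z • P := by rw [mul_sub, hPz, hPL, sub_zero]
  -- On the range of `P` the element `L` acts as `0`; on the complement `L` and `L + P` agree.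
  let u : 𝔸ˣ := ⟨algebraMap ℂ 𝔸 z - L, z⁻¹ • P + r * (1 - P), by
      rw [mul_add, mul_smul_comm, hzLP, inv_smul_smul₀ hz, haL, add_mul, ← mul_assoc, har, one_mul,
        ← mul_assoc, ← hrP, mul_assoc, hPQ, mul_zero]
      abel, by
      rw [add_mul, smul_mul_assoc, hzPL, inv_smul_smul₀ hz, haL, mul_assoc r, mul_add, hQP,
        add_zero, sub_mul, one_mul, ← haP, mul_sub, ← mul_assoc, hra, one_mul]
      abel⟩
  exact Ring.inverse_unit u

open WeightedDigraph in
/-- The Riesz projection onto a semisimple eigenvalue `0`. -/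
theorem rieszProj_eq {V : Type*} [Fintype V] {L P : (V → ℂ) →L[ℂ] (V → ℂ)} (hLP : L * P = 0)
    (hPL : P * L = 0) (hP : P * P = P) (hu : IsUnit (L + P)) : rieszProj L = P := by
  refine Tendsto.limUnder_eq (tendsto_nhds_of_eventually_eq ?_)
  have h0 : (0 : ℂ) ∈ resolventSet ℂ (L + P) := by
    rw [spectrum.mem_resolventSet_iff, map_zero, zero_sub]
    exact hu.neg
  obtain ⟨δ, hδ, hball⟩ := Metric.isOpen_iff.1 (spectrum.isOpen_resolventSet (𝕜 := ℂ) (L + P)) 0 h0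
  filter_upwards [Ioo_mem_nhdsGT hδ] with ε hε
  have hε0 : 0 < ε := hε.1
  have hsub : Metric.closedBall (0 : ℂ) ε ⊆ resolventSet ℂ (L + P) :=
    (Metric.closedBall_subset_ball hε.2).trans hball
  have hdiff : DifferentiableOn ℂ (fun z => resolvent (L + P) z * (1 - P))
      (Metric.closedBall (0 : ℂ) ε) := fun z hz =>
    ((spectrum.hasDerivAt_resolvent_const_left (hsub hz)).mul_const
      (1 - P)).differentiableAt.differentiableWithinAt
  have hcongr : (∮ z in C(0, ε), resolvent L z) =
      ∮ z in C(0, ε), ((z - 0)⁻¹ • P + resolvent (L + P) z * (1 - P)) := by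
    refine circleIntegral.integral_congr hε0.le fun z hz => ?_
    have hz0 : z ≠ 0 := by
      rintro rfl
      simp [hε0.ne] at hz
    rw [sub_zero]
    exact resolvent_eq_of_isIdempotent hLP hPL hP hz0 (hsub (Metric.sphere_subset_closedBall hz))
  have hint2 : CircleIntegrable (fun z => resolvent (L + P) z * (1 - P)) 0 ε :=
    (hdiff.continuousOn.mono Metric.sphere_subset_closedBall).circleIntegrable hε0.le
  have hint1 : CircleIntegrable (fun z : ℂ => (z - 0)⁻¹ • P) 0 ε := by
    refine ContinuousOn.circleIntegrable hε0.le fun z hz => ContinuousAt.continuousWithinAt ?_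
    have hz0 : z - 0 ≠ 0 := by
      rintro h
      rw [sub_zero] at h
      subst h
      simp [hε0.ne] at hz
    exact ((continuousAt_id.sub continuousAt_const).inv₀ hz0).smul continuousAt_const
  -- Invertibility of `L + P` makes this term holomorphic on the whole closed disc, so only the pole
  -- `z⁻¹ • P` contributes.
  have hzero : (∮ z in C(0, ε), resolvent (L + P) z * (1 - P)) = 0 := by
    refine DiffContOnCl.circleIntegral_eq_zero hε0.le (DifferentiableOn.diffContOnCl ?_)
    rwa [closure_ball _ hε0.ne']
  rw [rieszIntegral, hcongr, circleIntegral.integral_add hint1 hint2, hzero, add_zero,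
    circleIntegral.integral_smul_const, circleIntegral.integral_sub_center_inv _ hε0.ne',
    inv_smul_smul₀ Complex.two_pi_I_ne_zero]

end Riesz

namespace WeightedDigraph

variable {V : Type*} [Fintype V] {G : WeightedDigraph V} {F : Set (V × V)}

/-! ### The complex in-degree Laplacian -/

lemma inLap_apply (f : V → ℂ) (x : V) :
    G.inLap f x = (1 / (G.m x : ℂ)) * ∑ y, (G.a x y : ℂ) * (f x - f y) :=
  inLapLin_apply f x

lemma inLap_ofReal (u : V → ℝ) (x : V) :
    G.inLap (fun v => (u v : ℂ)) x = (G.inLapLin ℝ u x : ℂ) := by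
  rw [inLap_apply, inLapLin_apply]
  push_cast
  rfl

lemma re_inLap (f : V → ℂ) (x : V) :
    (G.inLap f x).re = G.inLapLin ℝ (fun v => (f v).re) x := by
  rw [inLap_apply, inLapLin_apply, ← Complex.ofReal_one, ← Complex.ofReal_div, Complex.re_ofReal_mul,
    Complex.re_sum]
  simp

lemma im_inLap (f : V → ℂ) (x : V) :
    (G.inLap f x).im = G.inLapLin ℝ (fun v => (f v).im) x := by
  rw [inLap_apply, inLapLin_apply, ← Complex.ofReal_one, ← Complex.ofReal_div, Complex.im_ofReal_mul,
    Complex.im_sum]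
  simp

lemma eq_sum_rightVec_of_inLap_eq_zero (hG : G.IsGraph) {ρ : G.Reach → V}
    (hρ : ∀ R, IsRoot R (ρ R)) {f : V → ℂ} (hf : G.inLap f = 0) (v : V) :
    f v = ∑ R, f (ρ R) * (G.rightVec R v : ℂ) := by
  have h1 := congrFun (eq_sum_rightVec hG hρ (u := fun v => (f v).re)
    (funext fun x => by rw [← re_inLap, hf]; simp)) v
  have h2 := congrFun (eq_sum_rightVec hG hρ (u := fun v => (f v).im)
    (funext fun x => by rw [← im_inLap, hf]; simp)) v
  simp only [Finset.sum_apply, Pi.smul_apply, smul_eq_mul] at h1 h2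
  apply Complex.ext
  · rw [h1, Complex.re_sum]; simp
  · rw [h2, Complex.im_sum]; simp

lemma inDegree_nonneg (hG : G.IsGraph) (x : V) : 0 ≤ G.inDegree x :=
  Finset.sum_nonneg fun y _ => hG.a_nonneg x y

/-- The in-degree Laplacian generates a contraction semigroup for the supremum norm. -/
lemma exists_inLap_eq (hG : G.IsGraph) {c : ℝ} (hc : 0 < c)
    (hd : ∀ x, G.inDegree x / G.m x ≤ c) :
    ∃ K : (V → ℂ) →L[ℂ] (V → ℂ), ‖K‖ ≤ 1 ∧ G.inLap = (c : ℂ) • (1 - K) := by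
  have hc' : (c : ℂ) ≠ 0 := Complex.ofReal_ne_zero.2 hc.ne'
  -- The bound `hd` makes the matrix of this operator nonnegative, with row sums `1`.
  refine ⟨1 - (c : ℂ)⁻¹ • G.inLap, ?_, by rw [sub_sub_cancel, smul_inv_smul₀ hc']⟩
  refine ContinuousLinearMap.opNorm_le_bound _ zero_le_one fun f => ?_
  rw [one_mul, pi_norm_le_iff_of_nonneg (norm_nonneg f)]
  intro x
  set θ := G.inDegree x / G.m x / c with hθ
  have hm := hG.m_pos x
  have hm' : (G.m x : ℂ) ≠ 0 := Complex.ofReal_ne_zero.2 hm.ne'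
  have h1 : (1 - (c : ℂ)⁻¹ • G.inLap) f x =
      ((1 - θ : ℝ) : ℂ) * f x + ((1 / (G.m x * c) : ℝ) : ℂ) * ∑ y, (G.a x y : ℂ) * f y := by
    have : G.inLap f x =
      (1 / (G.m x : ℂ)) * ((G.inDegree x : ℂ) * f x - ∑ y, (G.a x y : ℂ) * f y) := rfl
    change f x - (c : ℂ)⁻¹ * G.inLap f x = _
    rw [this, hθ]
    push_cast
    field_simp
    ring
  have hθ1 : θ ≤ 1 := by rw [hθ, div_le_one hc]; exact hd x
  have h2 : ‖∑ y, (G.a x y : ℂ) * f y‖ ≤ G.inDegree x * ‖f‖ := by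
    rw [inDegree, Finset.sum_mul]
    refine norm_sum_le_of_le _ fun y _ => ?_
    rw [norm_mul, Complex.norm_real, Real.norm_of_nonneg (hG.a_nonneg x y)]
    exact mul_le_mul_of_nonneg_left (norm_le_pi_norm f y) (hG.a_nonneg x y)
  rw [h1]
  refine (norm_add_le _ _).trans ?_
  rw [norm_mul, norm_mul, Complex.norm_real, Complex.norm_real,
    Real.norm_of_nonneg (sub_nonneg.2 hθ1),
    Real.norm_of_nonneg (show 0 ≤ 1 / (G.m x * c) by positivity)]
  calc _ ≤ (1 - θ) * ‖f‖ + 1 / (G.m x * c) * (G.inDegree x * ‖f‖) := by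
        gcongr
        exact norm_le_pi_norm f x
    _ = ‖f‖ := by rw [hθ]; field_simp; ring

lemma inDegree_restrict_le (hG : G.IsGraph) (F : Set (V × V)) (x : V) :
    (G.restrict F).inDegree x ≤ G.inDegree x := by
  refine Finset.sum_le_sum fun y _ => ?_
  simp only [restrict]
  split_ifs
  exacts [le_rfl, hG.a_nonneg x y]

lemma inLap_eq_add (hG : G.IsGraph) (F : Set (V × V)) :
    G.inLap = (G.restrict (G.E \ F)).inLap + (G.restrict F).inLap := by
  ext f x
  rw [_root_.add_apply, Pi.add_apply, inLap_apply, inLap_apply, inLap_apply]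
  change _ = (1 / (G.m x : ℂ)) * _ + (1 / (G.m x : ℂ)) * _
  rw [← mul_add, ← Finset.sum_add_distrib]
  congr 1
  refine Finset.sum_congr rfl fun y _ => ?_
  rw [← add_mul]
  congr 1
  simp only [restrict, Set.mem_sdiff]
  by_cases hE : (x, y) ∈ G.E
  · by_cases hF : (x, y) ∈ F <;> simp [hE, hF]
  · simp [hE, hG.a_eq_zero hE]

/-! ### The projection and the interpolation -/

lemma Jdown_apply (f : V → ℂ) (R : (G.restrict F).Reach) :
    G.Jdown F f R = ∑ x, ((G.restrict F).leftVec R x : ℂ) * f x * (G.m x : ℂ) := by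
  change ∑ x, _ = _
  simp only [Complex.conj_ofReal]

lemma Jup_apply (g : (G.restrict F).Reach → ℂ) (v : V) :
    G.Jup F g v = ∑ R, g R * ((G.restrict F).rightVec R v : ℂ) := rfl

lemma Jup_apply_of_isRoot {R : (G.restrict F).Reach} {r : V} (hr : IsRoot R r)
    (g : (G.restrict F).Reach → ℂ) : G.Jup F g r = g R := by
  classical
  simp [Jup_apply, rightVec_of_isRoot hr, apply_ite]

/-- The left vector times the mass is a probability measure on the roots of `R`. -/
lemma Jdown_congr (hG : G.IsGraph) {R : (G.restrict F).Reach} {f : V → ℂ} {z : ℂ}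
    (hf : ∀ r, IsRoot R r → f r = z) : G.Jdown F f R = z := by
  rw [Jdown_apply]
  have h1 : ∀ x, ((G.restrict F).leftVec R x : ℂ) * f x * (G.m x : ℂ) =
      z * (((G.restrict F).leftVec R x * (G.restrict F).m x : ℝ) : ℂ) := by
    intro x
    by_cases hx : IsRoot R x
    · rw [hf x hx]
      push_cast
      change _ = z * (_ * (G.m x : ℂ))
      ring
    · simp [leftVec_eq_zero hG.restrict hx]
  simp only [h1]
  rw [← Finset.mul_sum, ← Complex.ofReal_sum, sum_leftVec_mul_mass hG.restrict, Complex.ofReal_one,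
    mul_one]

lemma Jdown_Jup (hG : G.IsGraph) (g : (G.restrict F).Reach → ℂ) :
    G.Jdown F (G.Jup F g) = g :=
  funext fun _ => Jdown_congr hG fun _ hr => Jup_apply_of_isRoot hr g

lemma Jdown_inLap_apply (hG : G.IsGraph) (H : WeightedDigraph V) (hH : H.m = G.m) (f : V → ℂ)
    (R : (G.restrict F).Reach) : G.Jdown F (H.inLap f) R =
      ∑ x, ((G.restrict F).leftVec R x : ℂ) * ∑ y, (H.a x y : ℂ) * (f x - f y) := by
  rw [Jdown_apply]
  refine Finset.sum_congr rfl fun x _ => ?_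
  have hm : (G.m x : ℂ) ≠ 0 := Complex.ofReal_ne_zero.2 (hG.m_pos x).ne'
  rw [inLap_apply, hH]
  field_simp

lemma Jdown_inLap (hG : G.IsGraph) (f : V → ℂ) : G.Jdown F ((G.restrict F).inLap f) = 0 := by
  funext R
  rw [Jdown_inLap_apply hG (G.restrict F) rfl]
  have h1 : ∑ x, ((G.restrict F).leftVec R x : ℂ) * ∑ y, ((G.restrict F).a x y : ℂ) * (f x - f y) =
      ∑ x, (((G.restrict F).leftVec R x * ∑ y, (G.restrict F).a x y : ℝ) : ℂ) * f x -
        ∑ y, ((∑ x, (G.restrict F).leftVec R x * (G.restrict F).a x y : ℝ) : ℂ) * f y := by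
    push_cast
    simp only [Finset.mul_sum, Finset.sum_mul, mul_sub, Finset.sum_sub_distrib]
    congr 1
    · simp only [mul_assoc]
    · rw [Finset.sum_comm]
      simp only [mul_assoc]
  rw [h1, ← Finset.sum_sub_distrib]
  exact Finset.sum_eq_zero fun x _ => by rw [leftVec_balance hG.restrict, sub_self]

lemma inLap_Jup (hG : G.IsGraph) (g : (G.restrict F).Reach → ℂ) :
    (G.restrict F).inLap (G.Jup F g) = 0 := by
  have h1 : G.Jup F g = ∑ R, g R • fun v => ((G.restrict F).rightVec R v : ℂ) := by
    funext v
    simp [Jup_apply, Finset.sum_apply]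
  rw [h1, map_sum]
  refine Finset.sum_eq_zero fun R _ => ?_
  rw [map_smul]
  funext x
  rw [Pi.smul_apply, inLap_ofReal, inLapLin_rightVec hG.restrict]
  simp

/-- The projection onto the kernel of the in-degree Laplacian of the retained edges. -/
noncomputable def kerProj (G : WeightedDigraph V) (F : Set (V × V)) : (V → ℂ) →L[ℂ] (V → ℂ) :=
  G.Jup F ∘L G.Jdown F

lemma kerProj_mul_self (hG : G.IsGraph) : G.kerProj F * G.kerProj F = G.kerProj F := by
  refine ContinuousLinearMap.ext fun f => ?_
  exact congrArg (G.Jup F) (Jdown_Jup hG (G.Jdown F f))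

lemma inLap_mul_kerProj (hG : G.IsGraph) : (G.restrict F).inLap * G.kerProj F = 0 :=
  ContinuousLinearMap.ext fun f => inLap_Jup hG (G.Jdown F f)

lemma kerProj_mul_inLap (hG : G.IsGraph) : G.kerProj F * (G.restrict F).inLap = 0 :=
  ContinuousLinearMap.ext fun f =>
    (congrArg (G.Jup F) (Jdown_inLap hG f)).trans (map_zero (G.Jup F))

/-- If `(B + P) f = 0`, applying `P` gives `P f = 0`, hence `B f = 0`. The kernel of `B` is the
range of `P`, so `f = P f = 0`; finite dimension does the rest. -/
lemma isUnit_inLap_add_kerProj (hG : G.IsGraph) :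
    IsUnit ((G.restrict F).inLap + G.kerProj F) := by
  have hinj : Function.Injective ((G.restrict F).inLap + G.kerProj F) := by
    rw [injective_iff_map_eq_zero]
    intro f hf
    rw [_root_.add_apply] at hf
    have h1 : G.kerProj F f = 0 := by
      have := congrArg (G.kerProj F) hf
      rw [map_add, map_zero] at this
      have h2 : G.kerProj F ((G.restrict F).inLap f) = 0 :=
        DFunLike.congr_fun (kerProj_mul_inLap hG) f
      have h3 : G.kerProj F (G.kerProj F f) = G.kerProj F f :=
        DFunLike.congr_fun (kerProj_mul_self hG) f
      rwa [h2, h3, zero_add] at this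
    rw [h1, add_zero] at hf
    choose ρ hρ using exists_isRoot (G := G.restrict F)
    have h4 : f = G.Jup F (fun R => f (ρ R)) :=
      funext (eq_sum_rightVec_of_inLap_eq_zero hG.restrict hρ hf)
    rw [h4] at h1 ⊢
    change G.Jup F (G.Jdown F _) = 0 at h1
    rwa [Jdown_Jup hG] at h1
  rw [ContinuousLinearMap.isUnit_iff_bijective]
  exact ⟨hinj, ((G.restrict F).inLap + G.kerProj F).toLinearMap.surjective_of_injective hinj⟩

lemma exists_inLap_comp_eq (hG : G.IsGraph) :
    ∃ Bs, (G.restrict F).inLap ∘L Bs = 1 - G.Jup F ∘L G.Jdown F := by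
  have hu := isUnit_inLap_add_kerProj (F := F) hG
  set B := (G.restrict F).inLap
  have hP : G.kerProj F * Ring.inverse (B + G.kerProj F) = G.kerProj F := by
    have h1 : G.kerProj F * (B + G.kerProj F) = G.kerProj F := by
      rw [mul_add, kerProj_mul_inLap hG, kerProj_mul_self hG, zero_add]
    nth_rewrite 1 [← h1]
    rw [mul_assoc, Ring.mul_inverse_cancel _ hu, mul_one]
  -- The group inverse of `B`: it inverts `B` on the kernel of the projection and vanishes on its
  -- range.
  refine ⟨Ring.inverse (B + G.kerProj F) * (1 - G.kerProj F), ?_⟩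
  change B * _ = 1 - G.kerProj F
  rw [← add_sub_cancel_right B (G.kerProj F), sub_mul, ← mul_assoc, ← mul_assoc, add_sub_cancel_right,
    Ring.mul_inverse_cancel _ hu, hP, one_mul, mul_sub, mul_one, kerProj_mul_self hG, sub_self,
    sub_zero]

lemma rieszProj_inLap (hG : G.IsGraph) : rieszProj (G.restrict F).inLap = G.kerProj F :=
  rieszProj_eq (inLap_mul_kerProj hG) (kerProj_mul_inLap hG) (kerProj_mul_self hG)
    (isUnit_inLap_add_kerProj hG)

/-! ### The reduced graph -/

open Classical in
-- The indicator of `R` is `1` at roots of `R` and `0` at roots of the other reaches, and `Jdown`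
-- sees only roots.
lemma kerProj_indicator (hG : G.IsGraph) (R : (G.restrict F).Reach) (v : V) :
    G.kerProj F (Set.indicator R.1 1) v = ((G.restrict F).rightVec R v : ℂ) := by
  have h1 : G.Jdown F (Set.indicator R.1 1) = Pi.single R 1 := by
    funext S
    refine Jdown_congr hG fun r hr => ?_
    by_cases h : S = R
    · subst h
      simp [hr.mem]
    · rw [Pi.single_eq_of_ne h, Set.indicator_of_notMem]
      exact fun hr' => h (hr.eq_of_mem hr').symm
  change G.Jup F (G.Jdown F _) v = _
  rw [h1, Jup_apply]
  simp [Pi.single_apply]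

lemma reduced_m (hG : G.IsGraph) (R : (G.restrict F).Reach) :
    (G.reduced F).m R = ∑ v, (G.restrict F).rightVec R v * G.m v := by
  change (G.ellInner _ _).re = _
  rw [rieszProj_inLap hG, ellInner, Complex.re_sum]
  refine Finset.sum_congr rfl fun v _ => ?_
  rw [kerProj_indicator hG]
  by_cases hv : v ∈ R.1
  · simp [hv]
  · simp [hv, rightVec_of_notMem hv]

lemma reduced_m_pos (hG : G.IsGraph) (R : (G.restrict F).Reach) : 0 < (G.reduced F).m R := by
  rw [reduced_m hG]
  obtain ⟨r, hr⟩ := exists_isRoot R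
  refine Finset.sum_pos'
    (fun v _ => mul_nonneg (rightVec_nonneg hG.restrict R v) (hG.m_pos v).le) ⟨r, by simp, ?_⟩
  rw [rightVec_of_mem_exclusivePart hr.mem_exclusivePart, one_mul]
  exact hG.m_pos r

lemma reduced_a (hG : G.IsGraph) (R S : (G.restrict F).Reach) :
    (G.reduced F).a R S = (G.reduced F).m R * ∑ r, ∑ s,
      (G.restrict F).leftVec R r * G.a r s * (G.restrict F).rightVec S s := by
  change (G.reduced F).m R * _ = _
  congr 1
  refine Finset.sum_congr rfl fun r _ => Finset.sum_congr rfl fun s _ => ?_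
  by_cases hr : r ∈ R.1
  · by_cases hs : s ∈ S.1
    · simp [hr, hs]
    · simp [hs, rightVec_of_notMem hs]
  · simp [hr, leftVec_eq_zero hG.restrict fun h : IsRoot R r => hr h.mem]

theorem reduced_isGraph (hG : G.IsGraph) (F : Set (V × V)) : (G.reduced F).IsGraph where
  m_pos := reduced_m_pos hG
  a_nonneg R S := by
    rw [reduced_a hG]
    exact mul_nonneg (reduced_m_pos hG R).le <| Finset.sum_nonneg fun r _ =>
      Finset.sum_nonneg fun s _ => mul_nonneg (mul_nonneg (leftVec_nonneg hG.restrict R r)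
        (hG.a_nonneg r s)) (rightVec_nonneg hG.restrict S s)
  mem_E _ _ := Iff.rfl

lemma reduced_inLap (hG : G.IsGraph) (F : Set (V × V)) :
    (G.reduced F).inLap = G.Jdown F ∘L (G.restrict (G.E \ F)).inLap ∘L G.Jup F := by
  refine ContinuousLinearMap.ext fun g => funext fun R => ?_
  -- The reduced weights involve all edges of `G`; those in `F` contribute nothing on the range of
  -- `Jup`.
  have h1 : (G.restrict (G.E \ F)).inLap (G.Jup F g) = G.inLap (G.Jup F g) := by
    rw [inLap_eq_add hG F, _root_.add_apply, inLap_Jup hG, add_zero]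
  have hm : ((G.reduced F).m R : ℂ) ≠ 0 := Complex.ofReal_ne_zero.2 (reduced_m_pos hG R).ne'
  rw [ContinuousLinearMap.comp_apply, ContinuousLinearMap.comp_apply, h1,
    Jdown_inLap_apply hG _ rfl, inLap_apply]
  have h2 : ∀ y, ∑ S, ((G.restrict F).rightVec S y : ℂ) * (g R - g S) = g R - G.Jup F g y := by
    intro y
    have := congrArg (fun r : ℝ => (r : ℂ)) (sum_rightVec (hG.restrict (F := F)) y)
    simp only [Complex.ofReal_sum, Complex.ofReal_one] at this
    simp only [mul_sub, Finset.sum_sub_distrib, ← Finset.sum_mul, this, one_mul, Jup_apply,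
      mul_comm (g _)]
  -- The left vector lives on roots of `R`, where `Jup F g` equals `g R`. As the right vectors sum
  -- to `1`, the difference along an edge becomes an average of `g R - g S`.
  have h3 : ∀ x y, ((G.restrict F).leftVec R x : ℂ) * ((G.a x y : ℂ) *
      (G.Jup F g x - G.Jup F g y)) = ((G.restrict F).leftVec R x : ℂ) * ((G.a x y : ℂ) *
      ∑ S, ((G.restrict F).rightVec S y : ℂ) * (g R - g S)) := by
    intro x y
    by_cases hx : IsRoot R x
    · rw [h2, Jup_apply_of_isRoot hx]
    · simp [leftVec_eq_zero hG.restrict hx]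
  simp only [Finset.mul_sum (Finset.univ : Finset V), h3]
  simp only [reduced_a hG, Complex.ofReal_mul, Complex.ofReal_sum, mul_assoc]
  rw [← Finset.mul_sum, ← mul_assoc, one_div_mul_cancel hm, one_mul]
  simp only [Finset.sum_mul, Finset.mul_sum]
  rw [Finset.sum_comm]
  refine Finset.sum_congr rfl fun x _ => ?_
  rw [Finset.sum_comm]
  simp only [mul_assoc]

/-! ### The norm of `ℓ²(G)` -/

lemma ellNorm_le (hG : G.IsGraph) (f : V → ℂ) : G.ellNorm f ≤ √(∑ x, G.m x) * ‖f‖ := by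
  rw [← Real.sqrt_sq (norm_nonneg f), ← Real.sqrt_mul (Finset.sum_nonneg fun x _ =>
    (hG.m_pos x).le), Finset.sum_mul]
  refine Real.sqrt_le_sqrt (Finset.sum_le_sum fun x _ => ?_)
  have := hG.m_pos x
  have := norm_le_pi_norm f x
  rw [mul_comm]
  gcongr

lemma norm_le_ellNorm (hG : G.IsGraph) (f : V → ℂ) :
    ‖f‖ ≤ (∑ x, (√(G.m x))⁻¹) * G.ellNorm f := by
  have h0 : 0 ≤ G.ellNorm f := Real.sqrt_nonneg _
  rw [pi_norm_le_iff_of_nonneg (mul_nonneg (Finset.sum_nonneg fun x _ => by positivity) h0)]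
  intro x
  have hm := Real.sqrt_pos.2 (hG.m_pos x)
  have h1 : ‖f x‖ * √(G.m x) ≤ G.ellNorm f := by
    rw [← Real.sqrt_sq (norm_nonneg (f x)), ← Real.sqrt_mul (sq_nonneg _)]
    exact Real.sqrt_le_sqrt (Finset.single_le_sum (f := fun x => ‖f x‖ ^ 2 * G.m x)
      (fun y _ => mul_nonneg (sq_nonneg _) (hG.m_pos y).le) (Finset.mem_univ x))
  calc ‖f x‖ ≤ (√(G.m x))⁻¹ * G.ellNorm f := by rwa [le_inv_mul_iff₀ hm, mul_comm]
    _ ≤ _ := mul_le_mul_of_nonneg_right (Finset.single_le_sum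
      (f := fun x => (√(G.m x))⁻¹) (fun y _ => by positivity) (Finset.mem_univ x)) h0

lemma ellOpNorm_nonneg (T : (V → ℂ) →L[ℂ] (V → ℂ)) : 0 ≤ G.ellOpNorm T :=
  Real.sInf_nonneg fun _ hC => hC.1

/-- Transfers the limit from the supremum norm, in which the Laplacians generate contractions, to
`ℓ²(G)`. -/
lemma ellOpNorm_le (hG : G.IsGraph) (T : (V → ℂ) →L[ℂ] (V → ℂ)) :
    G.ellOpNorm T ≤ √(∑ x, G.m x) * (∑ x, (√(G.m x))⁻¹) * ‖T‖ := by
  have h0 : 0 ≤ ∑ x, (√(G.m x))⁻¹ := Finset.sum_nonneg fun x _ => by positivity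
  refine csInf_le ⟨0, fun _ hC => hC.1⟩ ⟨by positivity, fun f => ?_⟩
  calc G.ellNorm (T f) ≤ √(∑ x, G.m x) * (‖T‖ * ((∑ x, (√(G.m x))⁻¹) * G.ellNorm f)) := by
        refine (ellNorm_le hG _).trans ?_
        gcongr
        exact (T.le_opNorm f).trans (by gcongr; exact norm_le_ellNorm hG f)
    _ = _ := by ring

end WeightedDigraph

theorem mainTheorem6 {V : Type*} [Fintype V] (G : WeightedDigraph V) (hG : G.IsGraph)
    (F : Set (V × V)) (hF : F ⊆ G.E) :
    (G.reduced F).IsGraph ∧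
      ∀ t : ℝ, 0 < t →
        Filter.Tendsto
          (fun β : ℝ => G.ellOpNorm
            (NormedSpace.exp (-(t : ℂ) • G.inLapBeta F β) -
              (G.Jup F) ∘L (NormedSpace.exp (-(t : ℂ) • (G.reduced F).inLap)) ∘L (G.Jdown F)))
          Filter.atTop (nhds 0) := by
  refine ⟨WeightedDigraph.reduced_isGraph hG F, fun t ht => ?_⟩
  -- One constant serving both edge sets; the summand `1` keeps it positive when there are no edges.
  set c : ℝ := 1 + ∑ x, G.inDegree x / G.m x with hc_def
  have hnn : ∀ x ∈ Finset.univ, 0 ≤ G.inDegree x / G.m x := fun x _ =>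
    div_nonneg (WeightedDigraph.inDegree_nonneg hG x) (hG.m_pos x).le
  have hc : 0 < c := by have := Finset.sum_nonneg hnn; linarith
  have hd : ∀ (F' : Set (V × V)) (x : V),
      (G.restrict F').inDegree x / (G.restrict F').m x ≤ c := fun F' x => by
    have h1 := Finset.single_le_sum hnn (Finset.mem_univ x)
    have h2 : (G.restrict F').inDegree x / (G.restrict F').m x ≤ G.inDegree x / G.m x :=
      div_le_div_of_nonneg_right (WeightedDigraph.inDegree_restrict_le hG F' x) (hG.m_pos x).le
    linarith
  obtain ⟨KA, hKA, hA⟩ := WeightedDigraph.exists_inLap_eq (hG.restrict (F := G.E \ F)) hc (hd _)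
  obtain ⟨KB, hKB, hB⟩ := WeightedDigraph.exists_inLap_eq (hG.restrict (F := F)) hc (hd _)
  obtain ⟨Bs, hQ⟩ := WeightedDigraph.exists_inLap_comp_eq (F := F) hG
  have key := (tendsto_exp_add_smul hc ht hKA hKB hA hB
    (ContinuousLinearMap.ext (WeightedDigraph.inLap_Jup hG)) hQ
    (WeightedDigraph.reduced_inLap hG F)).norm.const_mul
      (√(∑ x, G.m x) * (∑ x, (√(G.m x))⁻¹))
  rw [norm_zero, mul_zero] at key
  exact squeeze_zero (fun _ => WeightedDigraph.ellOpNorm_nonneg _)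
    (fun _ => WeightedDigraph.ellOpNorm_le hG _) key
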